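/- Let $(\Omega,\mathcal F)$ be a measurable space and $\mathscr H$ a linear space of $\mathcal F$-measurable real functions on $\Omega$ such that $\varphi(X_1,\ldots,X_n)\in\mathscr H$ whenever $X_1,\ldots,X_n\in\mathscr H$ and $\varphi:\mathbb R^n\to\mathbb R$ satisfies $|\varphi(x)-\varphi(y)|\le C(1+|x|^m+|y|^m)|x-y|$ for some $C>0$, $m\in\mathbb N$. Let $\hat{\mathbb E}:\mathscr H\to[-\infty,\infty]$ be a sub-linear expectation: it is monotone, $\hat{\mathbb E}[c]=c$ for constants $c$, $\hat{\mathbb E}[X+Y]\le\hat{\mathbb E}[X]+\hat{\mathbb E}[Y]$ whenever the right-hand side is not of the form $\infty-\infty$, and $\hat{\mathbb E}[\lambda X]=\lambda\hat{\mathbb E}[X]$ for $\lambda\ge0$. Let $\mathscr H_b$ be the set of bounded elements of $\mathscr H$. For $A\subset\Omega$ put $$\hat V(A)=\inf\{\hat{\mathbb E}[\xi]: I_A\le\xi\in\mathscr H\},\qquad \widehat{\mathbb V}^*(A)=\inf\Big\{\sum_{n=1}^\infty\hat V(A_n): A\subset\bigcup_{n=1}^\infty A_n,\ A_n\in\mathcal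 F\Big\},$$ and let $C_{\hat V}(X)=\int_0^\infty\hat V(X\ge t)\,dt+\int_{-\infty}^0[\hat V(X\ge t)-1]\,dt$ be the Choquet integral. Assume condition (CC): $\mathscr P$ is a family of probability measures on $\sigma(\mathscr H)$ such that $\hat{\mathbb E}[X]=\sup_{P\in\mathscr P}E_P[X]$ for all $X\in\mathscr H_b$, and for every sequence $\boldsymbol Y=(Y_1,Y_2,\ldots)$ in $\mathscr H_b$ the family of laws $\{P\circ\boldsymbol Y^{-1}:P\in\mathscr P\}$ is a compact set of probability measures on $\mathbb R^{\mathbb N}$ (product topology) in the topology of weak convergence. Let $\{X_n;n\ge1\}\subset\mathscr H$ be i.i.d. under $\hat{\mathbb E}$, that is, $\hat{\mathbb E}[\varphi(X_i)]=\hat{\mathbb E}[\varphi(X_1)]$ for all $i\ge 1$ and all bounded Lipschitz $\varphi$ on $\mathbb R$, and $\hat{\mathbb E}[\varphi(X_1,\ldots,X_{i+1})]=\hat{\mathbb E}\big[\hat{\mathbb E}[\varphi(x_1,\ldots,x_i,X_{i+1})]\big|_{x_1=X_1,\ldots,x_i=X_i}\big]$ for all $i\ge1$ and all bounded Lipschitz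 $\varphi$ on $\mathbb R^{i+1}$. Assume $C_{\hat V}(|X_1|)<\infty$, and let $S_n=\sum_{i=1}^nX_i$. Then the limits $\overline\mu=\lim_{c\to\infty}\hat{\mathbb E}[(-c)\vee X_1\wedge c]$ and $\underline\mu=-\lim_{c\to\infty}\hat{\mathbb E}[(-c)\vee(-X_1)\wedge c]$ exist in $\mathbb R$, and the following hold. (a) For any Borel functions $\varphi_i:\mathbb R^i\to[\underline\mu,\overline\mu]$, $i=1,2,\ldots$, there is a probability measure $Q$ on $(\Omega,\sigma(\mathscr H))$ such that $E_Q[X]\le\hat{\mathbb E}[X]$ for all $X\in\mathscr H_b$ and $$\widehat{\mathbb V}^*\Big(\lim_{n\to\infty}\frac{S_n-\sum_{i=1}^n\varphi_i(X_1,\ldots,X_i)}{n}=0\Big)=Q\Big(\lim_{n\to\infty}\frac{S_n-\sum_{i=1}^n\varphi_i(X_1,\ldots,X_i)}{n}=0\Big)=1.$$ (b) For any continuous functions $\varphi_i:\mathbb R^i\to[\underline\mu,\overline\mu]$, $i=1,2,\ldots$, there is a probability measure $P\in\mathscr P$ such that $$\widehat{\mathbb V}^*\Big(\lim_{n\to\infty}\frac{S_n-\sum_{i=1}^n\varphi_i(X_1,\ldots,X_i)}{n}=0\Big)=P\Big(\lim_{n\to\infty}\frac{S_n-\sum_{i=1}^n\varphi_i(X_1,\ldots,X_i)}{n}=0\Big)=1.$$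 -/

import Mathlib

open MeasureTheory Filter Topology
open scoped ENNReal

/-- The class `C_{l,Lip}` of locally Lipschitz functions on `ℝⁿ` whose local Lipschitz constant grows
at most polynomially. (The sup norm of `Fin n → ℝ` gives the same class as the Euclidean norm.) -/
def IsLocLip {n : ℕ} (φ : (Fin n → ℝ) → ℝ) : Prop :=
  ∃ C : ℝ, 0 < C ∧ ∃ m : ℕ, ∀ x y : Fin n → ℝ,
    |φ x - φ y| ≤ C * (1 + ‖x‖ ^ m + ‖y‖ ^ m) * ‖x - y‖

/-- The class `C_{b,Lip}` of bounded Lipschitz functions. -/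
def IsBddLip {α : Type*} [PseudoEMetricSpace α] (φ : α → ℝ) : Prop :=
  (∃ M : ℝ, ∀ x, |φ x| ≤ M) ∧ ∃ K : NNReal, LipschitzWith K φ

/-- A sub-linear expectation space `(Ω, ℋ, 𝔼)` over the measurable space `Ω`.
The expectation is a function `ℋ → [-∞, ∞]`; it is written as a total function on `Ω → ℝ`, but its
axioms, and all notions below, involve only its values on `ℋ`. -/
structure SublinearExpectationSpace (Ω : Type*) [MeasurableSpace Ω] where
  /-- the linear space of random variables -/
  H : Submodule ℝ (Ω → ℝ)
  measurable_of_mem : ∀ X ∈ H, Measurable X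
  comp_mem : ∀ (n : ℕ) (X : Fin n → Ω → ℝ), (∀ i, X i ∈ H) →
    ∀ φ : (Fin n → ℝ) → ℝ, IsLocLip φ → (fun ω => φ (fun i => X i ω)) ∈ H
  /-- the sub-linear expectation -/
  E : (Ω → ℝ) → EReal
  mono : ∀ X ∈ H, ∀ Y ∈ H, (∀ ω, Y ω ≤ X ω) → E Y ≤ E X
  const : ∀ c : ℝ, E (fun _ => c) = (c : EReal)
  subadd : ∀ X ∈ H, ∀ Y ∈ H, ¬ (E X = ⊤ ∧ E Y = ⊥) → ¬ (E X = ⊥ ∧ E Y = ⊤) →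
    E (X + Y) ≤ E X + E Y
  pos_homog : ∀ X ∈ H, ∀ c : ℝ, 0 ≤ c → E (c • X) = (c : EReal) * E X

namespace SublinearExpectationSpace

variable {Ω : Type*} [MeasurableSpace Ω]

/-- The bounded elements `ℋ_b` of `ℋ`. -/
def Hb (S : SublinearExpectationSpace Ω) : Set (Ω → ℝ) :=
  {X | X ∈ S.H ∧ ∃ M : ℝ, ∀ ω, |X ω| ≤ M}

/-- The σ-algebra `σ(ℋ)` generated by `ℋ`. -/
abbrev sigmaH (S : SublinearExpectationSpace Ω) : MeasurableSpace Ω :=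
  ⨆ X ∈ S.H, MeasurableSpace.comap X (borel ℝ)

/-- Identical distribution of two random vectors, possibly on different spaces. -/
def IdentDist {Ω' : Type*} [MeasurableSpace Ω'] (S : SublinearExpectationSpace Ω)
    (S' : SublinearExpectationSpace Ω') {n : ℕ} (X : Fin n → Ω → ℝ) (X' : Fin n → Ω' → ℝ) : Prop :=
  ∀ φ : (Fin n → ℝ) → ℝ, IsBddLip φ →
    S.E (fun ω => φ (fun i => X i ω)) = S'.E (fun ω => φ (fun i => X' i ω))

/-- `Y` is independent to `X`: `𝔼[φ(X, Y)] = 𝔼[ 𝔼[φ(x, Y)] |_{x = X} ]`.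
As `φ` is bounded, the inner expectation is finite, so that `toReal` is harmless. -/
def IndepTo (S : SublinearExpectationSpace Ω) {n m : ℕ} (Y : Fin n → Ω → ℝ) (X : Fin m → Ω → ℝ) :
    Prop :=
  ∀ φ : (Fin m → ℝ) × (Fin n → ℝ) → ℝ, IsBddLip φ →
    S.E (fun ω => φ (fun i => X i ω, fun j => Y j ω)) =
      S.E (fun ω => (S.E (fun ω' => φ (fun i => X i ω, fun j => Y j ω'))).toReal)

/-- An i.i.d. sequence of random variables `X 0, X 1, …` in `ℋ`: all have the distribution of the
first one, and each is independent to the vector of its predecessors. -/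
structure IsIID (S : SublinearExpectationSpace Ω) (X : ℕ → Ω → ℝ) : Prop where
  mem : ∀ i, X i ∈ S.H
  identDist : ∀ i, IdentDist S S (fun _ : Fin 1 => X i) (fun _ : Fin 1 => X 0)
  indep : ∀ i, S.IndepTo (fun _ : Fin 1 => X (i + 1)) (fun j : Fin (i + 1) => X j)

/-- The upper capacity `A ↦ inf {𝔼[ξ] : 1_A ≤ ξ ∈ ℋ}`. Here `ξ ≥ 0`, hence `𝔼[ξ] ∈ [0, ∞]`. -/
noncomputable def upperCapacity (S : SublinearExpectationSpace Ω) (A : Set Ω) : ℝ≥0∞ :=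
  ⨅ (ξ : Ω → ℝ) (_ : ξ ∈ S.H) (_ : ∀ ω, A.indicator (fun _ => (1 : ℝ)) ω ≤ ξ ω), (S.E ξ).toENNReal

/-- The countably sub-additive extension of the upper capacity,
`A ↦ inf {∑ V(Aₙ) : A ⊆ ⋃ Aₙ}`, the `Aₙ` being events. -/
noncomputable def outerCapacity (S : SublinearExpectationSpace Ω) (A : Set Ω) : ℝ≥0∞ :=
  ⨅ (B : ℕ → Set Ω) (_ : ∀ n, MeasurableSet (B n)) (_ : A ⊆ ⋃ n, B n), ∑' n, S.upperCapacity (B n)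

/-- The Choquet integral `∫_0^∞ V(X ≥ t) dt + ∫_{-∞}^0 (V(X ≥ t) - 1) dt` with respect to the upper
capacity, which has values in `[0, 1]`. -/
noncomputable def choquet (S : SublinearExpectationSpace Ω) (X : Ω → ℝ) : EReal :=
  ((∫⁻ t in Set.Ioi (0 : ℝ), S.upperCapacity {ω | t ≤ X ω} : ℝ≥0∞) : EReal) -
    ((∫⁻ t in Set.Iio (0 : ℝ), (1 - S.upperCapacity {ω | t ≤ X ω}) : ℝ≥0∞) : EReal)

/-- The upper mean `lim_{c → ∞} 𝔼[(-c) ∨ X ∧ c]` of `X` exists and is the real number `μ`. -/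
def HasUpperMean (S : SublinearExpectationSpace Ω) (X : Ω → ℝ) (μ : ℝ) : Prop :=
  Tendsto (fun c : ℝ => S.E (fun ω => max (-c) (min (X ω) c))) atTop (𝓝 (μ : EReal))

/-- The lower mean of `X`, minus the upper mean of `-X`, exists and is the real number `μ`. -/
def HasLowerMean (S : SublinearExpectationSpace Ω) (X : Ω → ℝ) (μ : ℝ) : Prop :=
  S.HasUpperMean (-X) (-μ)

/-- Condition (CC) with the family `Pfam` of probability measures on `σ(ℋ)`: it represents `𝔼` on `ℋ_b`,
and for every sequence in `ℋ_b` the set of its laws under the members of `Pfam` is weakly compact. -/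
structure CC (S : SublinearExpectationSpace Ω) (Pfam : Set (@Measure Ω S.sigmaH)) : Prop where
  isProbability : ∀ P ∈ Pfam, IsProbabilityMeasure P
  representation : ∀ X ∈ S.Hb, S.E X = ⨆ P ∈ Pfam, ((∫ ω, X ω ∂P : ℝ) : EReal)
  compact : ∀ Y : ℕ → Ω → ℝ, (∀ i, Y i ∈ S.Hb) →
    IsCompact {ν : ProbabilityMeasure (ℕ → ℝ) |
      ∃ P ∈ Pfam, (ν : Measure (ℕ → ℝ)) =
        @Measure.map Ω (ℕ → ℝ) S.sigmaH _ (fun ω i => Y i ω) P}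

/-- The event `(S_n - ∑_{i ≤ n} φ_i(X_1, …, X_i)) / n → 0`. The sequences start at index `0`, so
that `φ i` is a function of `i + 1` variables. -/
def convSet (X : ℕ → Ω → ℝ) (φ : (i : ℕ) → (Fin (i + 1) → ℝ) → ℝ) : Set Ω :=
  {ω | Tendsto (fun n : ℕ =>
    (∑ i ∈ Finset.range n, X i ω -
      ∑ i ∈ Finset.range n, φ i (fun j : Fin (i + 1) => X j ω)) / (n : ℝ)) atTop (𝓝 0)}

end SublinearExpectationSpace

/-! By weak compactness the upper and the lower mean of `X 0` are attained: there are `P₁`, `P₂` in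
the representing family under which `X 0` has means `μhi` and `μlo`. Let `θ₁`, `θ₂` be its laws
under them. Since every `φ n` takes values in `[μlo, μhi]`, for each past `p` the function `x - φ n
(p, x)` has non-negative mean under `θ₁` and non-positive mean under `θ₂`, so some mixture of the
two laws centres it (`exists_balanced_kernel`). These mixtures are the transition kernels of a law
`Q` on sequences (`exists_isChainLaw`).

Under `Q` the variables `z n - φ n (z 0, …, z n)` are martingale differences. Their conditional laws
lie below `θ₁ + θ₂`, a finite measure with finite first moment, and a truncation argument gives the
strong law (`IsChainLaw.ae_tendsto_average`).

Each kernel is dominated by the sub-linear law of `X 0`. By independence, finite-dimensional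
expectations under `Q` are therefore dominated by those of `S.E` (`IsIID.isDominatedLaw`). Hence no
member of the family need have law `Q`, but compactness still yields a member giving probability one
to any prescribed Borel event of full `Q`-measure (`CC.exists_measure_eq_one`): inner closed
approximations are encoded in an increasing sequence of bounded Lipschitz penalties whose
expectations stay bounded.

This works for Borel `φ`, so one member of the family serves both claims. The capacity of the event
is one because each member lies below the capacity. -/

section Chain

/-! ### Laws on sequences with prescribed transition kernels. -/

open ProbabilityTheory

/-- The first `n` coordinates of a sequence. -/
def initialSegment (n : ℕ) (z : ℕ → ℝ) : Fin n → ℝ := fun j => z j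

lemma measurable_initialSegment (n : ℕ) : Measurable (initialSegment n) :=
  measurable_pi_lambda _ fun j => measurable_pi_apply (j : ℕ)

lemma map_compProd_comap {α β γ : Type*} [MeasurableSpace α] [MeasurableSpace β]
    [MeasurableSpace γ] (μ : Measure α) [IsProbabilityMeasure μ] (κ : Kernel β γ)
    [IsMarkovKernel κ] {r : α → β} (hr : Measurable r) :
    (μ ⊗ₘ κ.comap r hr).map (Prod.map r id) = (μ.map r) ⊗ₘ κ := by
  have : IsProbabilityMeasure (μ.map r) := Measure.isProbabilityMeasure_map hr.aemeasurable
  ext s hs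
  rw [Measure.map_apply (by fun_prop) hs, Measure.compProd_apply (hs.preimage (by fun_prop)),
    Measure.compProd_apply hs, lintegral_map (Kernel.measurable_kernel_prodMk_left hs) hr]
  rfl

/-- A law on sequences with prescribed conditional laws of each coordinate given the
preceding ones. -/
def IsChainLaw (Q : Measure (ℕ → ℝ)) (κ : (n : ℕ) → Kernel (Fin n → ℝ) ℝ) : Prop :=
  ∀ n, Q.map (fun z => (initialSegment n z, z n)) = (Q.map (initialSegment n)) ⊗ₘ κ n

/-- Ionescu-Tulcea. `Kernel.traj` starts from a given point at time 0, whereas here `κ 0` must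
produce the first coordinate. So a dummy coordinate is put at time 0, ignored by the kernels and
removed at the end by the shift `s`. -/
lemma exists_isChainLaw (κ : (n : ℕ) → Kernel (Fin n → ℝ) ℝ) [∀ n, IsMarkovKernel (κ n)] :
    ∃ Q : Measure (ℕ → ℝ), IsProbabilityMeasure Q ∧ IsChainLaw Q κ := by
  let r : (n : ℕ) → ((i : Finset.Iic n) → ℝ) → (Fin n → ℝ) := fun n w j =>
    w ⟨(j : ℕ) + 1, Finset.mem_Iic.2 j.2⟩
  have hr : ∀ n, Measurable (r n) := fun n =>
    measurable_pi_lambda _ fun j => measurable_pi_apply _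
  let κ' : (n : ℕ) → Kernel ((i : Finset.Iic n) → ℝ) ℝ := fun n => (κ n).comap (r n) (hr n)
  let x₀ : (i : Finset.Iic 0) → ℝ := fun _ => 0
  let R : Measure (ℕ → ℝ) := Kernel.traj (X := fun _ => ℝ) κ' 0 x₀
  let s : (ℕ → ℝ) → ℕ → ℝ := fun w n => w (n + 1)
  have hs : Measurable s := measurable_pi_lambda _ fun j => measurable_pi_apply _
  have hi := measurable_initialSegment
  refine ⟨R.map s, Measure.isProbabilityMeasure_map hs.aemeasurable, fun n => ?_⟩
  have h1 := Kernel.partialTraj_compProd_eq_map_traj (X := fun _ => ℝ) (κ := κ')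
    (Nat.zero_le n) (x₀ := x₀)
  have hpair : Measurable fun z : ℕ → ℝ => (initialSegment n z, z n) :=
    (hi n).prodMk (measurable_pi_apply n)
  have h2 : (fun z : ℕ → ℝ => (initialSegment n z, z n)) ∘ s =
      (Prod.map (r n) id) ∘ (fun x => (Preorder.frestrictLe (π := fun _ => ℝ) n x, x (n + 1))) := by
    ext z <;> rfl
  have h3 : initialSegment n ∘ s = r n ∘ Preorder.frestrictLe (π := fun _ => ℝ) n := by
    ext z; rfl
  rw [Measure.map_map hpair hs, Measure.map_map (hi n) hs, h2, h3,
    ← Measure.map_map ((hr n).prodMap measurable_id) (by fun_prop), ← h1,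
    map_compProd_comap, ← Measure.map_map (hr n) (by fun_prop),
    Kernel.traj_map_frestrictLe_apply]

variable {Q : Measure (ℕ → ℝ)} [IsProbabilityMeasure Q] {κ : (n : ℕ) → Kernel (Fin n → ℝ) ℝ}
  [∀ n, IsMarkovKernel (κ n)]

lemma measurable_initialSegment_prodMk (n : ℕ) :
    Measurable fun z : ℕ → ℝ => (initialSegment n z, z n) :=
  (measurable_initialSegment n).prodMk (measurable_pi_apply n)

lemma IsChainLaw.integral_eq (hQ : IsChainLaw Q κ) (n : ℕ) {h : (Fin n → ℝ) × ℝ → ℝ}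
    (hm : Measurable h) (hi : Integrable (fun z => h (initialSegment n z, z n)) Q) :
    ∫ z, h (initialSegment n z, z n) ∂Q =
      ∫ z, (∫ x, h (initialSegment n z, x) ∂κ n (initialSegment n z)) ∂Q := by
  have hp := measurable_initialSegment_prodMk n
  have : IsProbabilityMeasure (Q.map (initialSegment n)) :=
    Measure.isProbabilityMeasure_map (measurable_initialSegment n).aemeasurable
  have hi' : Integrable h ((Q.map (initialSegment n)) ⊗ₘ κ n) := by
    rw [← hQ n, integrable_map_measure hm.aestronglyMeasurable hp.aemeasurable]
    exact hi
  rw [← integral_map (f := h) hp.aemeasurable hm.aestronglyMeasurable, hQ n,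
    Measure.integral_compProd hi', integral_map (measurable_initialSegment n).aemeasurable]
  exact (hm.stronglyMeasurable.integral_kernel_prod_right' (κ := κ n)).aestronglyMeasurable

lemma IsChainLaw.lintegral_eq (hQ : IsChainLaw Q κ) (n : ℕ) {h : (Fin n → ℝ) × ℝ → ℝ≥0∞}
    (hm : Measurable h) :
    ∫⁻ z, h (initialSegment n z, z n) ∂Q =
      ∫⁻ z, (∫⁻ x, h (initialSegment n z, x) ∂κ n (initialSegment n z)) ∂Q := by
  have hp := measurable_initialSegment_prodMk n
  have : IsProbabilityMeasure (Q.map (initialSegment n)) :=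
    Measure.isProbabilityMeasure_map (measurable_initialSegment n).aemeasurable
  rw [← lintegral_map (f := h) hm hp, hQ n, Measure.lintegral_compProd hm,
    lintegral_map (hm.lintegral_kernel_prod_right' (κ := κ n)) (measurable_initialSegment n)]

end Chain

/-! ### Kronecker's lemma. -/

section Kronecker

/-- A form of Kronecker's lemma: if `∑ d i / (i + 1)` converges then `(∑_{i < n} d i) / n → 0`. -/
lemma tendsto_sum_div_of_tendsto_weighted {d : ℕ → ℝ} {c : ℝ}
    (h : Tendsto (fun n => ∑ i ∈ Finset.range n, d i / (i + 1)) atTop (𝓝 c)) :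
    Tendsto (fun n : ℕ => (∑ i ∈ Finset.range n, d i) / n) atTop (𝓝 0) := by
  set s : ℕ → ℝ := fun n => ∑ i ∈ Finset.range n, d i / (i + 1) with hs
  -- Summation by parts; after division by `n`, the limit of `s` meets its own Cesàro limit.
  have key : ∀ n : ℕ, ∑ i ∈ Finset.range n, d i = n * s n - ∑ i ∈ Finset.range n, s i := by
    intro n
    induction n with
    | zero => simp
    | succ n ih =>
      have : s (n + 1) = s n + d n / (n + 1) := Finset.sum_range_succ _ _
      have h0 : (n : ℝ) + 1 ≠ 0 := by positivity
      rw [Finset.sum_range_succ, ih, Finset.sum_range_succ, this]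
      push_cast
      field_simp
      ring
  have h2 : Tendsto (fun n : ℕ => s n - (n : ℝ)⁻¹ * ∑ i ∈ Finset.range n, s i) atTop
      (𝓝 (c - c)) := h.sub h.cesaro
  rw [sub_self] at h2
  refine h2.congr' ?_
  filter_upwards [eventually_gt_atTop 0] with n hn
  have h0 : (n : ℝ) ≠ 0 := by positivity
  rw [key]
  field_simp

lemma tendsto_sum_div_of_tendsto_zero {u : ℕ → ℝ} (h : Tendsto u atTop (𝓝 0)) :
    Tendsto (fun n : ℕ => (∑ i ∈ Finset.range n, u i) / n) atTop (𝓝 0) := by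
  simpa [div_eq_inv_mul] using h.cesaro

end Kronecker

/-! ### Moment bounds for truncated integrable laws. -/

section Tails

open ProbabilityTheory

lemma tsum_measure_abs_gt_lt_top (θ : Measure ℝ) [IsProbabilityMeasure θ] (hθ : Integrable id θ) :
    ∑' i : ℕ, θ {x | (i : ℝ) < |x|} < ∞ := by
  let _ : MeasureSpace ℝ := ⟨θ⟩
  exact tsum_prob_mem_Ioi_lt_top (Ω := ℝ) (X := fun x => |x|) hθ.abs (fun x => abs_nonneg x)

/-- The variance estimate from the classical strong law, applied to `|x|` on the probability space
`(ℝ, θ)`. Replacing `i` by `i + 1` in the denominator only helps, and the term `i = 0` vanishes. -/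
lemma sum_sq_truncated_le (θ : Measure ℝ) [IsProbabilityMeasure θ] (hθ : Integrable id θ) (n : ℕ) :
    ∑ i ∈ Finset.range n,
      (∫ x, {x : ℝ | |x| ≤ i}.indicator (fun x => x ^ 2) x ∂θ) / ((i : ℝ) + 1) ^ 2 ≤
        2 * ∫ x, |x| ∂θ := by
  have h := @sum_variance_truncation_le ℝ ⟨θ⟩ ‹_› (fun x => |x|) hθ.abs (fun x => abs_nonneg x) n
  refine le_trans (Finset.sum_le_sum fun i _ => ?_) h
  have h1 : ∀ x : ℝ, {x : ℝ | |x| ≤ i}.indicator (fun x => x ^ 2) x =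
      (truncation (fun x : ℝ => |x|) i ^ 2) x := by
    intro x
    rw [truncation_eq_of_nonneg (fun x => abs_nonneg x)]
    simp only [Pi.pow_apply, Function.comp, Set.indicator, Set.mem_ofPred_eq, Set.mem_Ioc, id]
    by_cases hx : x = 0
    · simp [hx]
    · have : 0 < |x| := abs_pos.2 hx
      by_cases h2 : |x| ≤ i <;> simp [h2, this]
  rw [integral_congr_ae (ae_of_all _ h1), div_eq_inv_mul]
  have hnn : 0 ≤ ∫ x, (truncation (fun x : ℝ => |x|) i ^ 2) x ∂θ :=
    integral_nonneg fun x => by simp only [Pi.pow_apply]; positivity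
  rcases Nat.eq_zero_or_pos i with rfl | hi
  · simp [truncation_zero]
  · refine mul_le_mul_of_nonneg_right ?_ hnn
    gcongr
    exact le_add_of_nonneg_right zero_le_one

end Tails

/-! ### The strong law for conditionally centred variables. -/

section StrongLaw

open ProbabilityTheory

/-- The filtration generated by the coordinates of a sequence; at time `n` the first `n`
coordinates are known. -/
def initialFiltration : Filtration ℕ (inferInstance : MeasurableSpace (ℕ → ℝ)) where
  seq n := MeasurableSpace.comap (initialSegment n) inferInstance
  mono' n m hnm := by
    have : initialSegment n = (fun p : Fin m → ℝ => fun j : Fin n => p (Fin.castLE hnm j)) ∘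
      initialSegment m := rfl
    beta_reduce
    rw [this, ← MeasurableSpace.comap_comp]
    exact MeasurableSpace.comap_mono (by
      rw [← measurable_iff_comap_le]
      exact measurable_pi_lambda _ fun j => measurable_pi_apply _)
  le' n := (measurable_initialSegment n).comap_le

lemma measurable_initialFiltration_coord {i n : ℕ} (h : i < n) :
    Measurable[initialFiltration n] fun z : ℕ → ℝ => z i := by
  have : (fun z : ℕ → ℝ => z i) = (fun p : Fin n → ℝ => p ⟨i, h⟩) ∘ initialSegment n := rfl
  rw [this]
  exact (measurable_pi_apply _).comp (comap_measurable _)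

lemma measurable_initialFiltration_segment {i n : ℕ} (h : i ≤ n) :
    Measurable[initialFiltration n] (initialSegment i) :=
  (comap_measurable (initialSegment i)).mono (initialFiltration.mono h) le_rfl

variable {Q : Measure (ℕ → ℝ)} [IsProbabilityMeasure Q] {κ : (n : ℕ) → Kernel (Fin n → ℝ) ℝ}
  [∀ n, IsMarkovKernel (κ n)]

/-- A function of the past and the present which is conditionally centred is orthogonal to
functions of the past. -/
lemma IsChainLaw.integral_mul_eq_zero (hQ : IsChainLaw Q κ) {n : ℕ} {T : (Fin n → ℝ) × ℝ → ℝ}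
    (hT : Measurable T) (hT0 : ∀ p, ∫ x, T (p, x) ∂κ n p = 0)
    {h : (ℕ → ℝ) → ℝ} (hh : Measurable[initialFiltration n] h)
    (hint : Integrable (fun z => h z * T (initialSegment n z, z n)) Q) :
    ∫ z, h z * T (initialSegment n z, z n) ∂Q = 0 := by
  obtain ⟨g, hg, rfl⟩ := hh.exists_eq_measurable_comp
  have := hQ.integral_eq n (h := fun q => g q.1 * T q) (by fun_prop) hint
  simp only [Function.comp] at this ⊢
  rw [this]
  simp [integral_const_mul, hT0]

lemma eLpNorm_one_le_of_integral_sq_le {f : (ℕ → ℝ) → ℝ} (hf : Measurable f)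
    (hb : ∃ B, ∀ z, |f z| ≤ B) {R : ℝ} (h : ∫ z, f z ^ 2 ∂Q ≤ R) :
    eLpNorm f 1 Q ≤ ENNReal.ofReal (1 + R) := by
  obtain ⟨B, hB⟩ := hb
  have hi : Integrable f Q := Integrable.of_bound hf.aestronglyMeasurable B (ae_of_all _ hB)
  have hi2 : Integrable (fun z => f z ^ 2) Q :=
    Integrable.of_bound (hf.pow_const 2).aestronglyMeasurable (B ^ 2) (ae_of_all _ fun z => by
      rw [Real.norm_eq_abs, abs_pow]; gcongr; exact hB z)
  rw [eLpNorm_one_eq_lintegral_enorm, ← ofReal_integral_norm_eq_lintegral_enorm hi]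
  refine ENNReal.ofReal_le_ofReal ?_
  calc ∫ z, ‖f z‖ ∂Q ≤ ∫ z, (1 + f z ^ 2) ∂Q := by
        refine integral_mono hi.norm ((integrable_const 1).add hi2) fun z => ?_
        simp only [Real.norm_eq_abs]
        nlinarith [sq_abs (f z), sq_nonneg (|f z| - 1), abs_nonneg (f z)]
    _ = 1 + ∫ z, f z ^ 2 ∂Q := by rw [integral_add (integrable_const 1) hi2]; simp
    _ ≤ 1 + R := by linarith

/-- The weighted sums of bounded, conditionally centred variables converge almost surely, if their
weighted variances are summable. -/
lemma IsChainLaw.ae_tendsto_sum_div (hQ : IsChainLaw Q κ) {T : (n : ℕ) → (Fin n → ℝ) × ℝ → ℝ}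
    (hT : ∀ n, Measurable (T n)) (hTb : ∀ n, ∃ B, ∀ q, |T n q| ≤ B)
    (hT0 : ∀ n p, ∫ x, T n (p, x) ∂κ n p = 0) {R : ℝ}
    (hR : ∀ n, ∑ i ∈ Finset.range n,
      (∫ z, T i (initialSegment i z, z i) ^ 2 ∂Q) / ((i : ℝ) + 1) ^ 2 ≤ R) :
    ∀ᵐ z ∂Q, Tendsto (fun n : ℕ => (∑ i ∈ Finset.range n, T i (initialSegment i z, z i)) / n)
      atTop (𝓝 0) := by
  set d : ℕ → (ℕ → ℝ) → ℝ := fun i z => T i (initialSegment i z, z i) with hd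
  set M : ℕ → (ℕ → ℝ) → ℝ := fun n z => ∑ i ∈ Finset.range n, d i z / ((i : ℝ) + 1) with hM
  have hMsucc : ∀ n z, M (n + 1) z = M n z + d n z / ((n : ℝ) + 1) := fun n z =>
    Finset.sum_range_succ _ _
  have hdm : ∀ i n, i < n → Measurable[initialFiltration n] (d i) := fun i n hin =>
    (hT i).comp ((measurable_initialFiltration_segment hin.le).prodMk
      (measurable_initialFiltration_coord hin))
  have hMm : ∀ n, Measurable[initialFiltration n] (M n) := fun n => by
    refine Finset.measurable_fun_sum _ fun i hi => ?_
    exact (hdm i n (Finset.mem_range.1 hi)).div_const _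
  have hle := initialFiltration.le
  have hMm' : ∀ n, Measurable (M n) := fun n => (hMm n).mono (hle n) le_rfl
  have hdm' : ∀ n, Measurable (d n) := fun n => (hdm n (n + 1) n.lt_succ_self).mono (hle _) le_rfl
  have hdb : ∀ n, ∃ B, ∀ z, |d n z| ≤ B := fun n => by
    obtain ⟨B, hB⟩ := hTb n
    exact ⟨B, fun z => hB _⟩
  have hMb : ∀ n, ∃ B, ∀ z, |M n z| ≤ B := fun n => by
    choose B hB using hdb
    refine ⟨∑ i ∈ Finset.range n, B i / ((i : ℝ) + 1), fun z =>
      (Finset.abs_sum_le_sum_abs _ _).trans (Finset.sum_le_sum fun i _ => ?_)⟩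
    rw [abs_div, abs_of_pos (a := (i : ℝ) + 1) (by positivity)]
    gcongr
    exact hB i z
  have hbdd : ∀ {f : (ℕ → ℝ) → ℝ}, Measurable f → (∃ B, ∀ z, |f z| ≤ B) → Integrable f Q := by
    rintro f hf ⟨B, hB⟩
    exact Integrable.of_bound hf.aestronglyMeasurable B (ae_of_all _ hB)
  have hmulb : ∀ {f g : (ℕ → ℝ) → ℝ}, (∃ B, ∀ z, |f z| ≤ B) → (∃ B, ∀ z, |g z| ≤ B) →
      ∃ B, ∀ z, |f z * g z| ≤ B := by
    rintro f g ⟨B, hB⟩ ⟨C, hC⟩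
    refine ⟨B * C, fun z => ?_⟩
    rw [abs_mul]
    exact mul_le_mul (hB z) (hC z) (abs_nonneg _) ((abs_nonneg _).trans (hB z))
  have horth : ∀ n (h : (ℕ → ℝ) → ℝ), Measurable[initialFiltration n] h →
      (∃ B, ∀ z, |h z| ≤ B) → ∫ z, h z * d n z ∂Q = 0 := fun n h hh hb =>
    hQ.integral_mul_eq_zero (hT n) (hT0 n) hh
      (hbdd ((hh.mono (hle n) le_rfl).mul (hdm' n)) (hmulb hb (hdb n)))
  -- Orthogonality to indicators of past events is the martingale property.
  have hmart : Martingale M initialFiltration Q := by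
    refine martingale_of_setIntegral_eq_succ (fun n => (hMm n).stronglyMeasurable)
      (fun n => hbdd (hMm' n) (hMb n)) fun n s hs => ?_
    have hs' := hle n s hs
    have h0 : ∫ z in s, d n z ∂Q = 0 := by
      rw [← integral_indicator hs', ← horth n (s.indicator 1)
        ((measurable_indicator_const_iff (1 : ℝ)).2 hs) ⟨1, fun z => ?_⟩]
      · congr 1 with z
        by_cases hz : z ∈ s <;> simp [hz]
      · by_cases hz : z ∈ s <;> simp [hz]
    simp_rw [hMsucc]
    rw [integral_add (hbdd (hMm' n) (hMb n)).integrableOn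
      ((hbdd (hdm' n) (hdb n)).div_const _).integrableOn, integral_div, h0]
    simp
  -- Cross terms vanish by orthogonality, so the martingale is bounded in L², hence in L¹, and
  -- converges almost surely.
  have hsq : ∀ n, ∫ z, M n z ^ 2 ∂Q =
      ∑ i ∈ Finset.range n, (∫ z, d i z ^ 2 ∂Q) / ((i : ℝ) + 1) ^ 2 := by
    intro n
    induction n with
    | zero => simp [hM]
    | succ n ih =>
      rw [Finset.sum_range_succ, ← ih]
      have i1 : Integrable (fun z => M n z ^ 2) Q :=
        hbdd ((hMm' n).pow_const 2) (by simpa only [sq] using hmulb (hMb n) (hMb n))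
      have i2 : Integrable (fun z => M n z * d n z) Q :=
        hbdd ((hMm' n).mul (hdm' n)) (hmulb (hMb n) (hdb n))
      have i3 : Integrable (fun z => d n z ^ 2) Q :=
        hbdd ((hdm' n).pow_const 2) (by simpa only [sq] using hmulb (hdb n) (hdb n))
      have : ∀ z, M (n + 1) z ^ 2 = M n z ^ 2 + 2 / ((n : ℝ) + 1) * (M n z * d n z) +
          d n z ^ 2 / ((n : ℝ) + 1) ^ 2 := fun z => by
        rw [hMsucc]; field_simp; ring
      simp_rw [this]
      rw [integral_add (f := fun z => M n z ^ 2 + 2 / ((n : ℝ) + 1) * (M n z * d n z))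
        (i1.add (i2.const_mul _)) (i3.div_const _), integral_add i1 (i2.const_mul _),
        integral_const_mul, horth n _ (hMm n) (hMb n), integral_div]
      ring
  have hL1 : ∀ n, eLpNorm (M n) 1 Q ≤ (1 + R).toNNReal := fun n =>
    eLpNorm_one_le_of_integral_sq_le (hMm' n) (hMb n) ((hsq n).trans_le (hR n))
  filter_upwards [hmart.submartingale.exists_ae_tendsto_of_bdd hL1] with z hz
  obtain ⟨c, hc⟩ := hz
  exact tendsto_sum_div_of_tendsto_weighted hc

lemma setIntegral_tail_tendsto_zero (θ : Measure ℝ) [IsProbabilityMeasure θ]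
    (hθ : Integrable id θ) (C : ℝ) :
    Tendsto (fun n : ℕ => ∫ x, {x : ℝ | (n : ℝ) < |x|}.indicator (fun x => |x| + C) x ∂θ)
      atTop (𝓝 0) := by
  have hi : Integrable (fun x : ℝ => |x| + C) θ := hθ.abs.add (integrable_const C)
  have h := tendsto_integral_of_dominated_convergence (μ := θ) (f := fun _ => (0 : ℝ))
    (F := fun (n : ℕ) x => {x : ℝ | (n : ℝ) < |x|}.indicator (fun x => |x| + C) x)
    (fun x => ‖|x| + C‖)
    (fun n => (hi.indicator (measurableSet_lt measurable_const
      continuous_abs.measurable)).aestronglyMeasurable) hi.norm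
    (fun n => ae_of_all _ fun x => norm_indicator_le_norm_self _ _)
    (ae_of_all _ fun x => by
      obtain ⟨N, hN⟩ := exists_nat_ge |x|
      refine tendsto_const_nhds.congr' ?_
      filter_upwards [eventually_ge_atTop N] with n hn
      have : ¬ (n : ℝ) < |x| := not_lt.2 (hN.trans (Nat.cast_le.2 hn))
      simp [this])
  simpa using h

/-- A strong law of large numbers for conditionally centred functions of a chain, whose
conditional laws are dominated by a fixed integrable measure. -/
theorem IsChainLaw.ae_tendsto_average (hQ : IsChainLaw Q κ) {θ₁ θ₂ : Measure ℝ}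
    [IsProbabilityMeasure θ₁] [IsProbabilityMeasure θ₂] (h₁ : Integrable id θ₁)
    (h₂ : Integrable id θ₂) (hκ : ∀ n p, κ n p ≤ θ₁ + θ₂)
    {D : (n : ℕ) → (Fin n → ℝ) × ℝ → ℝ} (hD : ∀ n, Measurable (D n)) {C : ℝ} (hC : 0 ≤ C)
    (hDC : ∀ n p x, |D n (p, x)| ≤ |x| + C) (hD0 : ∀ n p, ∫ x, D n (p, x) ∂κ n p = 0) :
    ∀ᵐ z ∂Q, Tendsto (fun n : ℕ => (∑ i ∈ Finset.range n, D i (initialSegment i z, z i)) / n)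
      atTop (𝓝 0) := by
  have hB : ∀ n : ℕ, MeasurableSet {x : ℝ | |x| ≤ n} := fun n =>
    measurableSet_le continuous_abs.measurable measurable_const
  have hB' : ∀ n : ℕ, MeasurableSet {x : ℝ | (n : ℝ) < |x|} := fun n =>
    measurableSet_lt measurable_const continuous_abs.measurable
  have hint : Integrable id (θ₁ + θ₂) := h₁.add_measure h₂
  have hDi : ∀ n p, Integrable (fun x => D n (p, x)) (κ n p) := fun n p => by
    refine Integrable.mono' (g := fun x => |x| + C)
      (((hint.mono_measure (hκ n p)).abs).add (integrable_const C)) ?_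
      (ae_of_all _ fun x => hDC n p x)
    exact ((hD n).comp measurable_prodMk_left).aestronglyMeasurable
  -- Truncation at level `n` makes second moments finite but spoils the centring; `ψ` below is the
  -- resulting conditional mean, and `T = T₀ - ψ` is centred again.
  set T₀ : (n : ℕ) → (Fin n → ℝ) × ℝ → ℝ := fun n q =>
    {x : ℝ | |x| ≤ n}.indicator (fun x => D n (q.1, x)) q.2 with hT₀
  have hT₀m : ∀ n, Measurable (T₀ n) := fun n => by
    have : T₀ n = {q : (Fin n → ℝ) × ℝ | |q.2| ≤ n}.indicator (D n) := by
      ext ⟨p, x⟩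
      simp [hT₀, Set.indicator]
    rw [this]
    exact (hD n).indicator (measurable_snd (hB n))
  have hT₀b : ∀ n q, |T₀ n q| ≤ n + C := by
    rintro n ⟨p, x⟩
    by_cases hx : |x| ≤ n
    · simp only [hT₀, Set.indicator, Set.mem_ofPred_eq, hx, if_true]
      linarith [hDC n p x]
    · simp only [hT₀, Set.indicator, Set.mem_ofPred_eq, hx, if_false, abs_zero]
      positivity
  have hT₀i : ∀ n p, Integrable (fun x => T₀ n (p, x)) (κ n p) := fun n p =>
    Integrable.of_bound ((hT₀m n).comp measurable_prodMk_left).aestronglyMeasurable (n + C)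
      (ae_of_all _ fun x => hT₀b n _)
  set ψ : (n : ℕ) → (Fin n → ℝ) → ℝ := fun n p => ∫ x, T₀ n (p, x) ∂κ n p with hψ
  have hψm : ∀ n, Measurable (ψ n) := fun n =>
    ((hT₀m n).stronglyMeasurable.integral_kernel_prod_right' (κ := κ n)).measurable
  have hψb : ∀ n p, |ψ n p| ≤ n + C := fun n p => by
    simpa using norm_integral_le_of_norm_le_const (μ := κ n p)
      (f := fun x => T₀ n (p, x)) (C := n + C) (ae_of_all _ fun x => hT₀b n (p, x))
  -- As `D` is centred, `ψ` is minus the mean of `D` over the tail; domination by `θ₁ + θ₂` bounds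
  -- it uniformly in the past.
  have hψτ : ∀ n p, |ψ n p| ≤
      ∫ x, {x : ℝ | (n : ℝ) < |x|}.indicator (fun x => |x| + C) x ∂(θ₁ + θ₂) := by
    intro n p
    have hi : Integrable ({x : ℝ | (n : ℝ) < |x|}.indicator fun x => |x| + C) (θ₁ + θ₂) :=
      (hint.abs.add (integrable_const C)).indicator (hB' n)
    have e : ψ n p = ∫ x, (T₀ n (p, x) - D n (p, x)) ∂κ n p := by
      rw [integral_sub (hT₀i n p) (hDi n p), hD0, sub_zero]
    rw [e]
    calc |∫ x, (T₀ n (p, x) - D n (p, x)) ∂κ n p|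
        ≤ ∫ x, {x : ℝ | (n : ℝ) < |x|}.indicator (fun x => |x| + C) x ∂κ n p := by
          rw [← Real.norm_eq_abs]
          refine norm_integral_le_of_norm_le (hi.mono_measure (hκ n p)) (ae_of_all _ fun x => ?_)
          by_cases hx : |x| ≤ n
          · simp [hT₀, Set.indicator, hx, not_lt.2 hx]
          · simpa [hT₀, Set.indicator, hx, not_le.1 hx] using hDC n p x
      _ ≤ _ := by
          refine integral_mono_measure (hκ n p) (ae_of_all _ fun x => ?_) hi
          exact Set.indicator_nonneg (fun x _ => by positivity) x
  have hτ : Tendsto (fun n : ℕ => ∫ x, {x : ℝ | (n : ℝ) < |x|}.indicator (fun x => |x| + C) x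
      ∂(θ₁ + θ₂)) atTop (𝓝 0) := by
    have h := (setIntegral_tail_tendsto_zero θ₁ h₁ C).add (setIntegral_tail_tendsto_zero θ₂ h₂ C)
    rw [add_zero] at h
    refine h.congr fun n => ?_
    rw [integral_add_measure]
    · exact (h₁.abs.add (integrable_const C)).indicator (hB' n)
    · exact (h₂.abs.add (integrable_const C)).indicator (hB' n)
  set T : (n : ℕ) → (Fin n → ℝ) × ℝ → ℝ := fun n q => T₀ n q - ψ n q.1 with hT
  have hTm : ∀ n, Measurable (T n) := fun n => (hT₀m n).sub ((hψm n).comp measurable_fst)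
  have hTb : ∀ n q, |T n q| ≤ 2 * (n + C) := fun n q => by
    have := abs_sub (T₀ n q) (ψ n q.1)
    linarith [hT₀b n q, hψb n q.1]
  have hT0 : ∀ n p, ∫ x, T n (p, x) ∂κ n p = 0 := fun n p => by
    simp only [hT]
    rw [integral_sub (hT₀i n p) (integrable_const _)]
    simp [hψ]
  set v : Measure ℝ → ℕ → ℝ := fun θ n =>
    ∫ x, {x : ℝ | |x| ≤ n}.indicator (fun x => x ^ 2) x ∂θ with hv
  have hvi : ∀ (θ : Measure ℝ) [IsFiniteMeasure θ] (n : ℕ),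
      Integrable ({x : ℝ | |x| ≤ n}.indicator fun x => x ^ 2) θ := fun θ _ n => by
    refine Integrable.of_bound ((measurable_id.pow_const 2).indicator (hB n)).aestronglyMeasurable
      ((n : ℝ) ^ 2) (ae_of_all _ fun x => ?_)
    by_cases hx : |x| ≤ n
    · simp only [Set.indicator, Set.mem_ofPred_eq, hx, if_true, norm_pow, Real.norm_eq_abs]
      gcongr
    · simp only [Set.indicator, Set.mem_ofPred_eq, hx, if_false, norm_zero]
      positivity
  -- Centring lowers the second moment, and `(|x| + C)² ≤ 2x² + 2C²`.
  have hT2 : ∀ n p, ∫ x, T n (p, x) ^ 2 ∂κ n p ≤ 2 * (v θ₁ n + v θ₂ n) + 2 * C ^ 2 := by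
    intro n p
    have i2 : Integrable (fun x => T₀ n (p, x) ^ 2) (κ n p) :=
      Integrable.of_bound (((hT₀m n).comp measurable_prodMk_left).pow_const 2).aestronglyMeasurable
        ((n + C) ^ 2) (ae_of_all _ fun x => by
          rw [norm_pow, Real.norm_eq_abs]; gcongr; exact hT₀b n _)
    have e : ∫ x, T n (p, x) ^ 2 ∂κ n p = ∫ x, T₀ n (p, x) ^ 2 ∂κ n p - ψ n p ^ 2 := by
      have : ∀ x, T n (p, x) ^ 2 = T₀ n (p, x) ^ 2 - (2 * ψ n p * T₀ n (p, x) - ψ n p ^ 2) :=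
        fun x => by simp only [hT]; ring
      simp_rw [this]
      rw [integral_sub (g := fun x => 2 * ψ n p * T₀ n (p, x) - ψ n p ^ 2) i2
        (((hT₀i n p).const_mul _).sub (integrable_const _)),
        integral_sub ((hT₀i n p).const_mul _) (integrable_const _), integral_const_mul]
      change _ - (2 * ψ n p * ψ n p - _) = _
      simp
      ring
    have e2 : ∫ x, T₀ n (p, x) ^ 2 ∂κ n p ≤
        ∫ x, (2 * {x : ℝ | |x| ≤ n}.indicator (fun x => x ^ 2) x + 2 * C ^ 2) ∂κ n p := by
      refine integral_mono i2 (((hvi _ n).const_mul 2).add (integrable_const _)) fun x => ?_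
      by_cases hx : |x| ≤ n
      · simp only [hT₀, Set.indicator, Set.mem_ofPred_eq, hx, if_true]
        have h3 : D n (p, x) ^ 2 ≤ (|x| + C) ^ 2 := by
          rw [← sq_abs (D n (p, x))]; gcongr; exact hDC n p x
        nlinarith [sq_abs x, sq_nonneg (|x| - C)]
      · simp only [hT₀, Set.indicator, Set.mem_ofPred_eq, hx, if_false]
        nlinarith [sq_nonneg C]
    have e3 : ∫ x, {x : ℝ | |x| ≤ n}.indicator (fun x => x ^ 2) x ∂κ n p ≤ v θ₁ n + v θ₂ n := by
      simp only [hv]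
      rw [← integral_add_measure (hvi θ₁ n) (hvi θ₂ n)]
      refine integral_mono_measure (hκ n p) (ae_of_all _ fun x => ?_) (hvi _ n)
      exact Set.indicator_nonneg (fun x _ => sq_nonneg x) x
    rw [integral_add ((hvi _ n).const_mul 2) (integrable_const _), integral_const_mul] at e2
    simp only [integral_const, probReal_univ, smul_eq_mul, one_mul] at e2
    nlinarith [sq_nonneg (ψ n p)]
  have hT2Q : ∀ n, ∫ z, T n (initialSegment n z, z n) ^ 2 ∂Q ≤
      2 * (v θ₁ n + v θ₂ n) + 2 * C ^ 2 := by
    intro n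
    have hi : Integrable (fun z => T n (initialSegment n z, z n) ^ 2) Q :=
      Integrable.of_bound (((hTm n).comp
        (measurable_initialSegment_prodMk n)).pow_const 2).aestronglyMeasurable
        ((2 * (n + C)) ^ 2) (ae_of_all _ fun x => by
          rw [norm_pow, Real.norm_eq_abs]; gcongr; exact hTb n _)
    rw [hQ.integral_eq n (h := fun q => T n q ^ 2) ((hTm n).pow_const 2) hi]
    refine (integral_mono_of_nonneg (ae_of_all _ fun z => integral_nonneg fun x => sq_nonneg _)
      (integrable_const _) (ae_of_all _ fun z => hT2 n _)).trans_eq ?_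
    simp
  have hsumm : Summable fun i : ℕ => 1 / ((i : ℝ) + 1) ^ 2 := by
    have := (summable_nat_add_iff 1).2 (Real.summable_one_div_nat_pow.2 one_lt_two)
    simpa using this
  have hlim := hQ.ae_tendsto_sum_div hTm (fun n => ⟨_, hTb n⟩) hT0
    (R := 2 * (2 * ∫ x, |x| ∂θ₁) + 2 * (2 * ∫ x, |x| ∂θ₂) +
      2 * C ^ 2 * ∑' i : ℕ, 1 / ((i : ℝ) + 1) ^ 2) (fun n => by
    have s1 := sum_sq_truncated_le θ₁ h₁ n
    have s2 := sum_sq_truncated_le θ₂ h₂ n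
    have s3 := hsumm.sum_le_tsum (Finset.range n) (fun i _ => by positivity)
    calc _ ≤ ∑ i ∈ Finset.range n, (2 * (v θ₁ i / ((i : ℝ) + 1) ^ 2) +
          2 * (v θ₂ i / ((i : ℝ) + 1) ^ 2) + 2 * C ^ 2 * (1 / ((i : ℝ) + 1) ^ 2)) := by
          refine Finset.sum_le_sum fun i _ => ?_
          rw [div_le_iff₀ (by positivity)]
          refine (hT2Q i).trans_eq ?_
          field_simp
      _ ≤ _ := by
          rw [Finset.sum_add_distrib, Finset.sum_add_distrib, ← Finset.mul_sum, ← Finset.mul_sum,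
            ← Finset.mul_sum]
          gcongr)
  -- Borel–Cantelli: almost surely the truncation is eventually inactive.
  have hbc : ∀ᵐ z ∂Q, ∀ᶠ n : ℕ in atTop, z ∉ {z : ℕ → ℝ | (n : ℝ) < |z n|} := by
    refine ae_eventually_notMem (ne_of_lt (lt_of_le_of_lt ?_ (ENNReal.add_lt_top.2
      ⟨tsum_measure_abs_gt_lt_top θ₁ h₁, tsum_measure_abs_gt_lt_top θ₂ h₂⟩)))
    rw [← ENNReal.tsum_add]
    refine ENNReal.tsum_le_tsum fun n => ?_
    have h := hQ.lintegral_eq n (h := fun q => {x : ℝ | (n : ℝ) < |x|}.indicator 1 q.2)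
      ((measurable_one.indicator (hB' n)).comp measurable_snd)
    have hset : MeasurableSet {z : ℕ → ℝ | (n : ℝ) < |z n|} :=
      (measurable_pi_apply (X := fun _ : ℕ => ℝ) n) (hB' n)
    have e : ∫⁻ z, {x : ℝ | (n : ℝ) < |x|}.indicator 1 (z n) ∂Q =
        Q {z : ℕ → ℝ | (n : ℝ) < |z n|} := by
      rw [← lintegral_indicator_one hset]
      rfl
    simp only [lintegral_indicator_one (hB' n)] at h
    rw [← e, h]
    calc _ ≤ ∫⁻ _, (θ₁ + θ₂) {x : ℝ | (n : ℝ) < |x|} ∂Q :=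
          lintegral_mono fun z => hκ n _ _
      _ = _ := by simp
  filter_upwards [hlim, hbc] with z hz1 hz2
  have hz3 : Tendsto (fun n : ℕ => ψ n (initialSegment n z)) atTop (𝓝 0) :=
    squeeze_zero_norm (fun n => hψτ n _) hτ
  have hz4 : Tendsto (fun n : ℕ => D n (initialSegment n z, z n) - T₀ n (initialSegment n z, z n))
      atTop (𝓝 0) := by
    refine tendsto_const_nhds.congr' ?_
    filter_upwards [hz2] with n hn
    have : |z n| ≤ n := not_lt.1 hn
    simp [hT₀, Set.indicator, this]
  -- Decomposition `D = T + ψ + (D - T₀)`.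
  have := (hz1.add (tendsto_sum_div_of_tendsto_zero hz3)).add (tendsto_sum_div_of_tendsto_zero hz4)
  simp only [add_zero] at this
  refine this.congr fun n => ?_
  rw [← add_div, ← add_div, ← Finset.sum_add_distrib, ← Finset.sum_add_distrib]
  congr 1
  refine Finset.sum_congr rfl fun i _ => ?_
  simp only [hT]
  ring

end StrongLaw

/-! ### Sub-linear expectations of bounded variables, and condition (CC). -/

namespace SublinearExpectationSpace

variable {Ω : Type*} [MeasurableSpace Ω] {S : SublinearExpectationSpace Ω}

lemma isLocLip_of_lipschitzWith {n : ℕ} {φ : (Fin n → ℝ) → ℝ} {K : NNReal}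
    (h : LipschitzWith K φ) : IsLocLip φ := by
  refine ⟨K + 1, by positivity, 0, fun x y => ?_⟩
  have h1 := h.dist_le_mul x y
  rw [Real.dist_eq, dist_eq_norm] at h1
  refine h1.trans ?_
  have h2 : (0 : ℝ) ≤ K := K.2
  refine mul_le_mul_of_nonneg_right ?_ (norm_nonneg _)
  simp only [pow_zero]
  linarith

lemma lipschitz_comp_mem {n : ℕ} {φ : (Fin n → ℝ) → ℝ} {K : NNReal} (h : LipschitzWith K φ)
    {X : Fin n → Ω → ℝ} (hX : ∀ i, X i ∈ S.H) : (fun ω => φ (fun i => X i ω)) ∈ S.H :=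
  S.comp_mem n X hX φ (isLocLip_of_lipschitzWith h)

lemma lipschitz_comp_mem_one {f : ℝ → ℝ} {K : NNReal} (h : LipschitzWith K f) {Z : Ω → ℝ}
    (hZ : Z ∈ S.H) : (fun ω => f (Z ω)) ∈ S.H :=
  lipschitz_comp_mem (n := 1) (φ := fun x => f (x 0)) (K := K * 1)
    (h.comp (LipschitzWith.eval (α := fun _ : Fin 1 => ℝ) 0)) (X := fun _ => Z) (fun _ => hZ)

lemma bddLip_comp_mem {n : ℕ} {φ : (Fin n → ℝ) → ℝ} (h : IsBddLip φ)
    {X : Fin n → Ω → ℝ} (hX : ∀ i, X i ∈ S.H) : (fun ω => φ (fun i => X i ω)) ∈ S.Hb := by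
  obtain ⟨⟨M, hM⟩, K, hK⟩ := h
  exact ⟨lipschitz_comp_mem hK hX, M, fun ω => hM _⟩

/-- Constants are functions of the empty vector. -/
lemma const_mem (c : ℝ) : (fun _ => c) ∈ S.H :=
  lipschitz_comp_mem (n := 0) (φ := fun _ => c) (LipschitzWith.const c) (X := fun _ _ => 0)
    (fun i => i.elim0)

lemma E_le_of_le {Y : Ω → ℝ} (hY : Y ∈ S.H) {M : ℝ} (h : ∀ ω, Y ω ≤ M) : S.E Y ≤ M := by
  rw [← S.const M]
  exact S.mono _ (const_mem M) _ hY h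

lemma le_E_of_le {Y : Ω → ℝ} (hY : Y ∈ S.H) {M : ℝ} (h : ∀ ω, M ≤ Y ω) : M ≤ S.E Y := by
  rw [← S.const M]
  exact S.mono _ hY _ (const_mem M) h

lemma coe_toReal_E {Y : Ω → ℝ} (hY : Y ∈ S.Hb) : ((S.E Y).toReal : EReal) = S.E Y := by
  obtain ⟨hY, M, hM⟩ := hY
  refine EReal.coe_toReal (ne_top_of_le_ne_top (EReal.coe_ne_top M)
    (E_le_of_le hY fun ω => (abs_le.1 (hM ω)).2)) ?_
  exact ne_bot_of_le_ne_bot (EReal.coe_ne_bot (-M)) (le_E_of_le hY fun ω => (abs_le.1 (hM ω)).1)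

lemma abs_toReal_E_le {Y : Ω → ℝ} (hY : Y ∈ S.H) {M : ℝ} (hM : ∀ ω, |Y ω| ≤ M) :
    |(S.E Y).toReal| ≤ M := by
  have h := coe_toReal_E (S := S) ⟨hY, M, hM⟩
  rw [abs_le, ← EReal.coe_le_coe_iff, ← EReal.coe_le_coe_iff, h]
  exact ⟨le_E_of_le hY fun ω => (abs_le.1 (hM ω)).1, E_le_of_le hY fun ω => (abs_le.1 (hM ω)).2⟩

/-- The expectation is `1`-Lipschitz for the supremum distance. -/
lemma toReal_E_le_add {Y Z : Ω → ℝ} (hY : Y ∈ S.Hb) (hZ : Z ∈ S.Hb) {ε : ℝ}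
    (h : ∀ ω, Y ω ≤ Z ω + ε) : (S.E Y).toReal ≤ (S.E Z).toReal + ε := by
  have hε : S.E (fun _ => ε) = (ε : EReal) := S.const ε
  have h1 : S.E Y ≤ S.E (Z + fun _ => ε) :=
    S.mono _ (S.H.add_mem hZ.1 (const_mem ε)) _ hY.1 h
  have h2 : S.E (Z + fun _ => ε) ≤ S.E Z + S.E (fun _ => ε) :=
    S.subadd _ hZ.1 _ (const_mem ε) (by simp [hε]) (by simp [hε])
  have h3 := h1.trans h2
  rw [← coe_toReal_E hY, ← coe_toReal_E hZ, hε] at h3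
  exact_mod_cast h3

lemma measurable_sigmaH {Y : Ω → ℝ} (hY : Y ∈ S.H) : Measurable[S.sigmaH] Y :=
  (comap_measurable Y).mono
    (le_iSup₂ (f := fun Z (_ : Z ∈ S.H) => MeasurableSpace.comap Z (borel ℝ)) Y hY) le_rfl

lemma measurable_sigmaH_pi {X : ℕ → Ω → ℝ} (hX : ∀ i, X i ∈ S.H) :
    Measurable[S.sigmaH] fun ω i => X i ω :=
  @measurable_pi_lambda _ _ _ S.sigmaH _ _ fun i => measurable_sigmaH (hX i)

variable {Pfam : Set (@Measure Ω S.sigmaH)}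

lemma integrable_of_mem_Hb {P : @Measure Ω S.sigmaH} [IsFiniteMeasure P] {Y : Ω → ℝ}
    (hY : Y ∈ S.Hb) : Integrable Y P := by
  obtain ⟨hY, M, hM⟩ := hY
  exact Integrable.of_bound (measurable_sigmaH hY).aestronglyMeasurable M (ae_of_all _ hM)

namespace CC

lemma integral_le_E (hCC : S.CC Pfam) {P : @Measure Ω S.sigmaH} (hP : P ∈ Pfam) {Y : Ω → ℝ}
    (hY : Y ∈ S.Hb) : ((∫ ω, Y ω ∂P : ℝ) : EReal) ≤ S.E Y := by
  rw [hCC.representation Y hY]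
  exact le_iSup₂ (f := fun (P : @Measure Ω S.sigmaH) (_ : P ∈ Pfam) =>
    ((∫ ω, Y ω ∂P : ℝ) : EReal)) P hP

lemma integral_le (hCC : S.CC Pfam) {P : @Measure Ω S.sigmaH} (hP : P ∈ Pfam) {Y : Ω → ℝ}
    (hY : Y ∈ S.Hb) : ∫ ω, Y ω ∂P ≤ (S.E Y).toReal := by
  rw [← EReal.coe_le_coe_iff, coe_toReal_E hY]
  exact hCC.integral_le_E hP hY

lemma exists_lt_integral (hCC : S.CC Pfam) {Y : Ω → ℝ} (hY : Y ∈ S.Hb) {a : ℝ}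
    (ha : a < (S.E Y).toReal) : ∃ P ∈ Pfam, a < ∫ ω, Y ω ∂P := by
  rw [← EReal.coe_lt_coe_iff, coe_toReal_E hY, hCC.representation Y hY] at ha
  obtain ⟨P, hP⟩ := lt_iSup_iff.1 ha
  obtain ⟨hP, h⟩ := lt_iSup_iff.1 hP
  exact ⟨P, hP, EReal.coe_lt_coe_iff.1 h⟩

lemma nonempty (hCC : S.CC Pfam) : Pfam.Nonempty := by
  have h0 : (fun _ : Ω => (0 : ℝ)) ∈ S.Hb := ⟨const_mem 0, 0, by simp⟩
  obtain ⟨P, hP, -⟩ := hCC.exists_lt_integral h0 (a := -1) (by simp [S.const 0])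
  exact ⟨P, hP⟩

/-- Markov's inequality for `min ξ 1`: the cut-off is needed because the representation covers only
bounded variables. The set need not lie in `σ(ℋ)`; there `P` denotes its outer measure. -/
lemma measure_le_upperCapacity (hCC : S.CC Pfam) {P : @Measure Ω S.sigmaH} (hP : P ∈ Pfam)
    (B : Set Ω) : P B ≤ S.upperCapacity B := by
  have := hCC.isProbability P hP
  refine le_iInf fun ξ => le_iInf fun hξ => le_iInf fun hB => ?_
  have hξ0 : ∀ ω, 0 ≤ ξ ω := fun ω =>
    (Set.indicator_nonneg (fun _ _ => zero_le_one) ω).trans (hB ω)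
  have hH : (fun ω => min (ξ ω) 1) ∈ S.H :=
    lipschitz_comp_mem_one (f := fun x => min x 1) (LipschitzWith.id.min_const 1) hξ
  have hb : (fun ω => min (ξ ω) 1) ∈ S.Hb := ⟨hH, 1, fun ω => by
    rw [abs_of_nonneg (le_min (hξ0 ω) zero_le_one)]; exact min_le_right _ _⟩
  have hm := measurable_sigmaH hH
  have hle : ((∫ ω, min (ξ ω) 1 ∂P : ℝ) : EReal) ≤ S.E ξ :=
    (hCC.integral_le_E hP hb).trans (S.mono _ hξ _ hH fun ω => min_le_left _ _)
  calc P B ≤ P {ω | 1 ≤ ENNReal.ofReal (min (ξ ω) 1)} := by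
        refine measure_mono fun ω hω => ?_
        have := hB ω
        rw [Set.indicator_of_mem hω] at this
        simp [this]
    _ ≤ ∫⁻ ω, ENNReal.ofReal (min (ξ ω) 1) ∂P := by
        have := mul_meas_ge_le_lintegral (μ := P) hm.ennreal_ofReal 1
        simpa only [one_mul] using this
    _ = ENNReal.ofReal (∫ ω, min (ξ ω) 1 ∂P) := by
        rw [ofReal_integral_eq_lintegral_ofReal (integrable_of_mem_Hb hb)
          (ae_of_all _ fun ω => le_min (hξ0 ω) zero_le_one)]
    _ ≤ (S.E ξ).toENNReal := by
        have := EReal.toENNReal_le_toENNReal hle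
        simpa using this

lemma upperCapacity_univ (hCC : S.CC Pfam) : S.upperCapacity Set.univ = 1 := by
  obtain ⟨P, hP⟩ := hCC.nonempty
  have := hCC.isProbability P hP
  refine le_antisymm ?_ ?_
  · refine (iInf₂_le (fun _ => (1 : ℝ)) (const_mem 1)).trans ?_
    refine (iInf_le _ (fun ω => by simp)).trans ?_
    rw [S.const 1]
    exact (EReal.toENNReal_of_ne_top (EReal.coe_ne_top 1)).trans_le (by simp)
  · rw [← measure_univ (μ := P)]
    exact hCC.measure_le_upperCapacity hP _

/-- The cover by the whole space and empty sets gives `≤ 1`; countable sub-additivity of `P`, which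
lies below the capacity, gives `≥ 1`. -/
lemma outerCapacity_eq_one (hCC : S.CC Pfam) {P : @Measure Ω S.sigmaH} (hP : P ∈ Pfam)
    {A : Set Ω} (hA : P A = 1) : S.outerCapacity A = 1 := by
  refine le_antisymm ?_ ?_
  · let B : ℕ → Set Ω := fun n => if n = 0 then Set.univ else ∅
    have hB : ∀ n, MeasurableSet (B n) := fun n => by
      by_cases h : n = 0 <;> simp [B, h]
    have hAB : A ⊆ ⋃ n, B n := fun ω _ => Set.mem_iUnion.2 ⟨0, by simp [B]⟩
    refine (iInf₂_le B hB).trans ((iInf_le _ hAB).trans ?_)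
    have h0 : S.upperCapacity ∅ = 0 := by
      refine le_antisymm ?_ zero_le
      refine (iInf₂_le (fun _ => (0 : ℝ)) (const_mem 0)).trans ?_
      refine (iInf_le _ (fun ω => by simp)).trans ?_
      rw [S.const 0]
      simp
    rw [tsum_eq_single 0 fun n hn => by simp [B, hn, h0]]
    simp [B, hCC.upperCapacity_univ]
  · refine le_iInf fun B => le_iInf fun _ => le_iInf fun hAB => ?_
    calc 1 = P A := hA.symm
      _ ≤ P (⋃ n, B n) := measure_mono hAB
      _ ≤ ∑' n, P (B n) := measure_iUnion_le B
      _ ≤ _ := ENNReal.tsum_le_tsum fun n => hCC.measure_le_upperCapacity hP _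

/-- Compactness of the representing family: along an ultrafilter, expectations of countably many
bounded variables converge to expectations under a member of the family. -/
lemma exists_tendsto_integral (hCC : S.CC Pfam) {W : ℕ → Ω → ℝ} (hW : ∀ k, W k ∈ S.Hb)
    {P : ℕ → @Measure Ω S.sigmaH} (hP : ∀ n, P n ∈ Pfam) (U : Ultrafilter ℕ) :
    ∃ P' ∈ Pfam, ∀ k, Tendsto (fun n => ∫ ω, W k ω ∂(P n)) U (𝓝 (∫ ω, W k ω ∂P')) := by
  have hm := measurable_sigmaH_pi (S := S) fun k => (hW k).1
  have hprob := fun n => hCC.isProbability (P n) (hP n)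
  let ν : ℕ → ProbabilityMeasure (ℕ → ℝ) := fun n =>
    ⟨@Measure.map Ω (ℕ → ℝ) S.sigmaH _ (fun ω i => W i ω) (P n),
      Measure.isProbabilityMeasure_map hm.aemeasurable⟩
  obtain ⟨ν', ⟨P', hP', hν'⟩, hlim⟩ := (hCC.compact W hW).ultrafilter_le_nhds (U.map ν) (by
    rw [le_principal_iff, Ultrafilter.mem_coe, Ultrafilter.mem_map]
    exact Filter.univ_mem' fun n => ⟨P n, hP n, rfl⟩)
  refine ⟨P', hP', fun k => ?_⟩
  obtain ⟨-, M, hM⟩ := hW k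
  have hM0 : ∀ ω, -M ≤ W k ω ∧ W k ω ≤ M := fun ω => abs_le.1 (hM ω)
  -- Clipping the `k`-th coordinate at a bound of `W k` changes nothing on the laws and gives a test
  -- function for weak convergence.
  let f : BoundedContinuousFunction (ℕ → ℝ) ℝ := BoundedContinuousFunction.ofNormedAddCommGroup
    (fun y => max (-M) (min (y k) M)) (by fun_prop) |M| (fun y => by
      rw [Real.norm_eq_abs, abs_le]
      have h1 := le_abs_self M
      have h2 := neg_abs_le M
      exact ⟨le_max_of_le_left (by linarith), max_le (by linarith) ((min_le_right _ _).trans h1)⟩)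
  have hf : ∀ (ρ : @Measure Ω S.sigmaH), 
      ∫ y, f y ∂(@Measure.map Ω (ℕ → ℝ) S.sigmaH _ (fun ω i => W i ω) ρ) = ∫ ω, W k ω ∂ρ := by
    intro ρ
    rw [integral_map hm.aemeasurable f.continuous.measurable.aestronglyMeasurable]
    refine integral_congr_ae (ae_of_all _ fun ω => ?_)
    change max (-M) (min (W k ω) M) = W k ω
    rw [min_eq_left (hM0 ω).2, max_eq_right (hM0 ω).1]
  have hl : Tendsto ν U (𝓝 ν') := hlim
  have := (ProbabilityMeasure.tendsto_iff_forall_integral_tendsto.1 hl) f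
  rw [hν', hf] at this
  exact this.congr fun n => hf (P n)

end CC

/-! ### Choquet tails, and attainment of the upper mean. -/

/-- The integral of the upper capacity over the tails of `|Z|`. -/
noncomputable def capacityTail (S : SublinearExpectationSpace Ω) (Z : Ω → ℝ) (c : ℝ) : ℝ≥0∞ :=
  ∫⁻ t in Set.Ioi c, S.upperCapacity {ω | t ≤ |Z ω|}

lemma capacityTail_ne_top {Z : Ω → ℝ} (h : S.capacityTail Z 0 ≠ ⊤) {c : ℝ} (hc : 0 ≤ c) :
    S.capacityTail Z c ≠ ⊤ :=
  ne_top_of_le_ne_top h (lintegral_mono_set (Set.Ioi_subset_Ioi hc))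

/-- The capacity of `{t ≤ |Z|}`, as a function of `t`, is the density of a finite measure on the
half-line, whose tails shrink to the empty set. -/
lemma tendsto_capacityTail {Z : Ω → ℝ} (h : S.capacityTail Z 0 ≠ ⊤) :
    Tendsto (fun c => (S.capacityTail Z c).toReal) atTop (𝓝 0) := by
  let V : ℝ → ℝ≥0∞ := fun t => S.upperCapacity {ω | t ≤ |Z ω|}
  let ρ : Measure ℝ := (volume.restrict (Set.Ioi 0)).withDensity V
  have hρ : ∀ c, 0 ≤ c → ρ (Set.Ioi c) = S.capacityTail Z c := fun c hc => by
    rw [withDensity_apply _ measurableSet_Ioi, Measure.restrict_restrict measurableSet_Ioi,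
      Set.inter_eq_left.2 (Set.Ioi_subset_Ioi hc)]
    rfl
  have h1 : Tendsto (fun c : ℝ => ρ (Set.Ioi c)) atTop (𝓝 (ρ (⋂ c : ℝ, Set.Ioi c))) := by
    refine tendsto_measure_iInter_atTop (fun c => measurableSet_Ioi.nullMeasurableSet)
      (fun a b hab => Set.Ioi_subset_Ioi hab) ⟨0, ?_⟩
    rw [hρ 0 le_rfl]
    exact h
  have h2 : (⋂ c : ℝ, Set.Ioi c) = ∅ := by
    refine Set.eq_empty_of_forall_notMem fun x hx => ?_
    exact lt_irrefl x (Set.mem_iInter.1 hx x)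
  rw [h2, measure_empty] at h1
  have h3 : Tendsto (fun c => S.capacityTail Z c) atTop (𝓝 0) := by
    refine h1.congr' ?_
    filter_upwards [eventually_ge_atTop 0] with c hc using hρ c hc
  exact (ENNReal.tendsto_toReal ENNReal.zero_ne_top).comp h3

lemma abs_clip_sub_le (x : ℝ) {c : ℝ} (hc : 0 ≤ c) :
    |max (-c) (min x c) - x| ≤ max (|x| - c) 0 := by
  rcases le_total x c with h | h
  · rw [min_eq_left h]
    rcases le_total (-c) x with h' | h'
    · rw [max_eq_right h']; simp
    · rw [max_eq_left h', abs_of_nonneg (by linarith), abs_of_nonpos (by linarith)]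
      exact le_max_of_le_left (by linarith)
  · rw [min_eq_right h, max_eq_right (by linarith), abs_of_nonpos (by linarith),
      abs_of_nonneg (by linarith)]
    exact le_max_of_le_left (by linarith)

lemma clip_mem_Hb {Z : Ω → ℝ} (hZ : Z ∈ S.H) (c : ℝ) :
    (fun ω => max (-c) (min (Z ω) c)) ∈ S.Hb := by
  refine ⟨lipschitz_comp_mem_one (f := fun x => max (-c) (min x c))
    ((LipschitzWith.id.min_const c).const_max (-c)) hZ, |c|, fun ω => abs_le.2 ⟨?_, ?_⟩⟩
  · exact le_max_of_le_left (neg_le_neg (le_abs_self c))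
  · exact max_le (neg_le_abs c) ((min_le_right _ _).trans (le_abs_self c))

namespace CC

/-- The layer-cake formula and `P ≤ V`. The bound does not depend on `P`, so `Z` is uniformly
integrable over the family. -/
lemma lintegral_excess_le (hCC : S.CC Pfam) {P : @Measure Ω S.sigmaH} (hP : P ∈ Pfam) {Z : Ω → ℝ}
    (hZ : Z ∈ S.H) (c : ℝ) :
    ∫⁻ ω, ENNReal.ofReal (max (|Z ω| - c) 0) ∂P ≤ S.capacityTail Z c := by
  have hm := measurable_sigmaH hZ
  have hm' : Measurable[S.sigmaH] fun ω => max (|Z ω| - c) 0 :=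
    (((continuous_abs.measurable.comp hm).sub_const c).max measurable_const)
  rw [@lintegral_eq_lintegral_meas_le Ω S.sigmaH (fun ω => max (|Z ω| - c) 0) P
    (ae_of_all _ fun ω => le_max_right _ _) hm'.aemeasurable]
  have e : S.capacityTail Z c =
      ∫⁻ t in Set.Ioi (0 : ℝ), S.upperCapacity {ω | t + c ≤ |Z ω|} := by
    rw [capacityTail, ← lintegral_indicator measurableSet_Ioi,
      ← lintegral_indicator measurableSet_Ioi, ← lintegral_add_right_eq_self _ c]
    refine lintegral_congr fun t => ?_
    by_cases ht : 0 < t <;> simp [Set.indicator, ht]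
  rw [e]
  refine setLIntegral_mono' measurableSet_Ioi fun t ht => ?_
  refine le_trans (measure_mono fun ω hω => ?_) (hCC.measure_le_upperCapacity hP _)
  rcases le_max_iff.1 (show t ≤ max (|Z ω| - c) 0 from hω) with h | h
  · exact le_sub_iff_add_le.1 h
  · exact absurd h (not_le.2 ht)

lemma integrable_of_capacityTail (hCC : S.CC Pfam) {P : @Measure Ω S.sigmaH} (hP : P ∈ Pfam)
    {Z : Ω → ℝ} (hZ : Z ∈ S.H) (h : S.capacityTail Z 0 ≠ ⊤) : Integrable Z P := by
  refine ⟨(measurable_sigmaH hZ).aestronglyMeasurable, ?_⟩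
  refine lt_of_le_of_lt ?_ (lt_top_iff_ne_top.2 h)
  refine le_trans (le_of_eq ?_) (hCC.lintegral_excess_le hP hZ 0)
  refine lintegral_congr fun ω => ?_
  rw [sub_zero, max_eq_left (abs_nonneg _), ← Real.norm_eq_abs, ofReal_norm]

lemma abs_integral_clip_sub_le (hCC : S.CC Pfam) {P : @Measure Ω S.sigmaH} (hP : P ∈ Pfam)
    {Z : Ω → ℝ} (hZ : Z ∈ S.H) (h : S.capacityTail Z 0 ≠ ⊤) {c : ℝ} (hc : 0 ≤ c) :
    |∫ ω, max (-c) (min (Z ω) c) ∂P - ∫ ω, Z ω ∂P| ≤ (S.capacityTail Z c).toReal := by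
  have := hCC.isProbability P hP
  have hi := hCC.integrable_of_capacityTail hP hZ h
  have hm' : Measurable[S.sigmaH] fun ω => max (|Z ω| - c) 0 :=
    (((continuous_abs.measurable.comp (measurable_sigmaH hZ)).sub_const c).max measurable_const)
  have hle := hCC.lintegral_excess_le hP hZ c
  rw [← integral_sub (integrable_of_mem_Hb (clip_mem_Hb hZ c)) hi, ← Real.norm_eq_abs]
  refine (norm_integral_le_of_norm_le (g := fun ω => max (|Z ω| - c) 0)
    ((hi.abs.sub (integrable_const c)).sup (integrable_const 0))
    (ae_of_all _ fun ω => abs_clip_sub_le (Z ω) hc)).trans ?_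
  rw [integral_eq_lintegral_of_nonneg_ae (f := fun ω => max (|Z ω| - c) 0)
    (ae_of_all _ fun ω => le_max_right _ _)
    hm'.aestronglyMeasurable]
  exact ENNReal.toReal_mono (capacityTail_ne_top h hc) hle

/-- The upper mean of a variable with finite Choquet moment exists, and it is the mean under a
member of the representing family. -/
theorem exists_hasUpperMean (hCC : S.CC Pfam) {Z : Ω → ℝ} (hZ : Z ∈ S.H)
    (h : S.capacityTail Z 0 ≠ ⊤) :
    ∃ μ : ℝ, S.HasUpperMean Z μ ∧ ∃ P ∈ Pfam, ∫ ω, Z ω ∂P = μ := by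
  set τ : ℝ → ℝ := fun c => (S.capacityTail Z c).toReal with hτ
  have hτ0 : Tendsto τ atTop (𝓝 0) := tendsto_capacityTail h
  have hclip : ∀ P ∈ Pfam, ∀ c : ℝ, 0 ≤ c →
      |∫ ω, max (-c) (min (Z ω) c) ∂P - ∫ ω, Z ω ∂P| ≤ τ c := fun P hP c hc =>
    hCC.abs_integral_clip_sub_le hP hZ h hc
  set A : Set ℝ := (fun P : @Measure Ω S.sigmaH => ∫ ω, Z ω ∂P) '' Pfam with hA
  have hAne : A.Nonempty := hCC.nonempty.image _
  have hAbdd : BddAbove A := by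
    refine ⟨(S.E (fun ω => max (-0) (min (Z ω) 0))).toReal + τ 0, ?_⟩
    rintro _ ⟨P, hP, rfl⟩
    have h1 := (abs_le.1 (hclip P hP 0 le_rfl)).1
    have h2 := hCC.integral_le hP (clip_mem_Hb hZ 0)
    simp only
    linarith
  set μ : ℝ := sSup A with hμ
  have hle : ∀ P ∈ Pfam, ∫ ω, Z ω ∂P ≤ μ := fun P hP => le_csSup hAbdd ⟨P, hP, rfl⟩
  -- Clipping moves every mean by at most `τ c`, hence also the supremum of the means.
  have hE : ∀ c : ℝ, 0 ≤ c → |(S.E (fun ω => max (-c) (min (Z ω) c))).toReal - μ| ≤ τ c := by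
    intro c hc
    refine abs_le.2 ⟨?_, ?_⟩
    · have : μ ≤ (S.E (fun ω => max (-c) (min (Z ω) c))).toReal + τ c := by
        refine csSup_le hAne ?_
        rintro _ ⟨P, hP, rfl⟩
        have h1 := (abs_le.1 (hclip P hP c hc)).1
        have h2 := hCC.integral_le hP (clip_mem_Hb hZ c)
        simp only
        linarith
      linarith
    · rw [sub_le_iff_le_add]
      refine le_of_forall_lt fun a ha => ?_
      obtain ⟨P, hP, hPa⟩ := hCC.exists_lt_integral (clip_mem_Hb hZ c) ha
      have h1 := (abs_le.1 (hclip P hP c hc)).2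
      linarith [hle P hP]
  refine ⟨μ, ?_, ?_⟩
  · have h1 : Tendsto (fun c : ℝ => (S.E (fun ω => max (-c) (min (Z ω) c))).toReal) atTop
        (𝓝 μ) := by
      rw [tendsto_iff_norm_sub_tendsto_zero]
      refine squeeze_zero' (Eventually.of_forall fun c => norm_nonneg _) ?_ hτ0
      filter_upwards [eventually_ge_atTop 0] with c hc using hE c hc
    exact ((continuous_coe_real_ereal.tendsto μ).comp h1).congr fun c =>
      coe_toReal_E (clip_mem_Hb hZ c)
  · have hex : ∀ n : ℕ, ∃ P ∈ Pfam, μ - 1 / ((n : ℝ) + 1) < ∫ ω, Z ω ∂P := fun n => by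
      obtain ⟨_, ⟨P, hP, rfl⟩, hPa⟩ := exists_lt_of_lt_csSup hAne
        (show μ - 1 / ((n : ℝ) + 1) < sSup A from sub_lt_self _ (by positivity))
      exact ⟨P, hP, hPa⟩
    choose P hP hPa using hex
    -- `Z` may be unbounded, so the limit of a maximizing sequence is taken for all integer
    -- clippings at once; undoing them under `P n` and under `P'` costs `2 * τ k`.
    obtain ⟨P', hP', hlim⟩ := hCC.exists_tendsto_integral
      (W := fun (k : ℕ) ω => max (-(k : ℝ)) (min (Z ω) k)) (fun k => clip_mem_Hb hZ k) hP
      (hyperfilter ℕ)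
    refine ⟨P', hP', le_antisymm (hle P' hP') ?_⟩
    have h1 : ∀ k : ℕ, μ - 2 * τ k ≤ ∫ ω, Z ω ∂P' := fun k => by
      have h2 : Tendsto (fun n : ℕ => μ - 1 / ((n : ℝ) + 1) - τ k) (hyperfilter ℕ)
          (𝓝 (μ - 0 - τ k)) :=
        (((tendsto_const_nhds.sub tendsto_one_div_add_atTop_nhds_zero_nat).sub_const _)).mono_left
          Nat.hyperfilter_le_atTop
      have h3 := le_of_tendsto_of_tendsto' h2 (hlim k) fun n => by
        have := (abs_le.1 (hclip (P n) (hP n) k k.cast_nonneg)).1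
        linarith [hPa n]
      have := (abs_le.1 (hclip P' hP' k k.cast_nonneg)).2
      linarith
    have h2 : Tendsto (fun k : ℕ => μ - 2 * τ k) atTop (𝓝 (μ - 2 * 0)) :=
      tendsto_const_nhds.sub ((hτ0.comp tendsto_natCast_atTop_atTop).const_mul 2)
    simpa using le_of_tendsto' h2 h1

/-- For `t < 0` the event `t ≤ |Z|` is the whole space, of capacity one, so the negative part of the
Choquet integral vanishes. -/
lemma capacityTail_ne_top_of_choquet (hCC : S.CC Pfam) {Z : Ω → ℝ}
    (h : S.choquet (fun ω => |Z ω|) < ⊤) : S.capacityTail Z 0 ≠ ⊤ := by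
  have h0 : ∫⁻ t in Set.Iio (0 : ℝ), (1 - S.upperCapacity {ω | t ≤ |Z ω|}) = 0 := by
    rw [setLIntegral_congr_fun (g := fun _ => 0) measurableSet_Iio, lintegral_zero]
    intro t ht
    have : {ω | t ≤ |Z ω|} = Set.univ :=
      Set.eq_univ_of_forall fun ω => (le_of_lt (Set.mem_Iio.1 ht)).trans (abs_nonneg (Z ω))
    simp [this, hCC.upperCapacity_univ]
  intro htop
  rw [capacityTail] at htop
  rw [choquet, h0, htop] at h
  simp at h

end CC

end SublinearExpectationSpace

/-! ### Stability of bounded Lipschitz functions. -/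

section BoundedLipschitz

lemma IsBddLip.neg {α : Type*} [PseudoEMetricSpace α] {f : α → ℝ} (hf : IsBddLip f) :
    IsBddLip fun x => - f x := by
  obtain ⟨⟨M, hM⟩, K, hK⟩ := hf
  exact ⟨⟨M, fun x => by rw [abs_neg]; exact hM x⟩, K, hK.neg⟩

lemma IsBddLip.add {α : Type*} [PseudoEMetricSpace α] {f g : α → ℝ} (hf : IsBddLip f)
    (hg : IsBddLip g) : IsBddLip fun x => f x + g x := by
  obtain ⟨⟨M, hM⟩, K, hK⟩ := hf
  obtain ⟨⟨N, hN⟩, L, hL⟩ := hg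
  exact ⟨⟨M + N, fun x => (abs_add_le _ _).trans (add_le_add (hM x) (hN x))⟩, K + L, hK.add hL⟩

lemma IsBddLip.const_mul {α : Type*} [PseudoEMetricSpace α] {f : α → ℝ} (hf : IsBddLip f) (c : ℝ) :
    IsBddLip fun x => c * f x := by
  obtain ⟨⟨M, hM⟩, K, hK⟩ := hf
  refine ⟨⟨|c| * M, fun x => ?_⟩, ‖c‖₊ * K, (lipschitzWith_smul c).comp hK⟩
  rw [abs_mul]
  exact mul_le_mul_of_nonneg_left (hM x) (abs_nonneg c)

lemma IsBddLip.sum {α ι : Type*} [PseudoEMetricSpace α] {f : ι → α → ℝ} (s : Finset ι)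
    (hf : ∀ i ∈ s, IsBddLip (f i)) : IsBddLip fun x => ∑ i ∈ s, f i x := by
  classical
  induction s using Finset.induction_on with
  | empty => exact ⟨⟨0, by simp⟩, 0, by simp⟩
  | insert i s hi ih =>
    simp only [Finset.sum_insert hi]
    exact (hf i (Finset.mem_insert_self i s)).add
      (ih fun j hj => hf j (Finset.mem_insert_of_mem hj))

lemma IsBddLip.comp {α β : Type*} [PseudoEMetricSpace α] [PseudoEMetricSpace β] {f : β → ℝ}
    (hf : IsBddLip f) {g : α → β} {K : NNReal} (hg : LipschitzWith K g) :
    IsBddLip fun x => f (g x) := by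
  obtain ⟨⟨M, hM⟩, L, hL⟩ := hf
  exact ⟨⟨M, fun x => hM _⟩, L * K, hL.comp hg⟩

lemma IsBddLip.measurable {α : Type*} [PseudoEMetricSpace α] [MeasurableSpace α]
    [OpensMeasurableSpace α] {f : α → ℝ} (hf : IsBddLip f) : Measurable f := by
  obtain ⟨-, K, hK⟩ := hf
  exact hK.continuous.measurable

lemma lipschitzWith_snoc (n : ℕ) : LipschitzWith 1 fun q : (Fin n → ℝ) × ℝ =>
    (Fin.snoc (α := fun _ => ℝ) q.1 q.2 : Fin (n + 1) → ℝ) := by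
  refine LipschitzWith.of_dist_le_mul fun q r => ?_
  rw [NNReal.coe_one, one_mul, dist_pi_le_iff dist_nonneg]
  intro i
  refine Fin.lastCases ?_ (fun j => ?_) i
  · simp only [Fin.snoc_last]
    exact le_max_right _ _
  · simp only [Fin.snoc_castSucc]
    exact (dist_le_pi_dist q.1 r.1 j).trans (le_max_left _ _)

lemma snoc_eq {n : ℕ} (z : ℕ → ℝ) :
    (Fin.snoc (α := fun _ => ℝ) (fun j : Fin n => z j) (z n) : Fin (n + 1) → ℝ) =
      fun j : Fin (n + 1) => z j := by
  ext i
  refine Fin.lastCases ?_ (fun j => ?_) i <;> simp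

end BoundedLipschitz

/-! ### Lipschitz cylinder functions increasing to the indicator of an open set. -/

section CylinderApproximation

/-- A bounded Lipschitz function of the first `j` coordinates, which approximates the indicator of
the complement of `F` from below. -/
noncomputable def cylinderGap (F : Set (ℕ → ℝ)) (j : ℕ) (p : Fin j → ℝ) : ℝ :=
  min 1 (j * Metric.infDist p (initialSegment j '' F))

lemma cylinderGap_nonneg (F : Set (ℕ → ℝ)) (j : ℕ) (p : Fin j → ℝ) : 0 ≤ cylinderGap F j p :=
  le_min zero_le_one (mul_nonneg j.cast_nonneg Metric.infDist_nonneg)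

lemma cylinderGap_le_one (F : Set (ℕ → ℝ)) (j : ℕ) (p : Fin j → ℝ) : cylinderGap F j p ≤ 1 :=
  min_le_left _ _

lemma isBddLip_cylinderGap (F : Set (ℕ → ℝ)) (j : ℕ) : IsBddLip (cylinderGap F j) :=
  ⟨⟨1, fun p => by
    rw [abs_of_nonneg (cylinderGap_nonneg F j p)]; exact cylinderGap_le_one F j p⟩,
    ‖(j : ℝ)‖₊ * 1, ((lipschitzWith_smul (j : ℝ)).comp
      (Metric.lipschitz_infDist_pt (initialSegment j '' F))).const_min 1⟩

lemma cylinderGap_eq_zero {F : Set (ℕ → ℝ)} {z : ℕ → ℝ} (hz : z ∈ F) (j : ℕ) :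
    cylinderGap F j (initialSegment j z) = 0 := by
  rw [cylinderGap, Metric.infDist_zero_of_mem (Set.mem_image_of_mem _ hz)]
  simp

lemma cylinderGap_mono {F : Set (ℕ → ℝ)} (hF : F.Nonempty) (z : ℕ → ℝ) {i j : ℕ} (hij : i ≤ j) :
    cylinderGap F i (initialSegment i z) ≤ cylinderGap F j (initialSegment j z) := by
  refine min_le_min le_rfl (mul_le_mul (Nat.cast_le.2 hij) ?_ Metric.infDist_nonneg
    j.cast_nonneg)
  refine (Metric.le_infDist (hF.image _)).2 ?_
  rintro _ ⟨y, hy, rfl⟩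
  refine (Metric.infDist_le_dist_of_mem (Set.mem_image_of_mem _ hy)).trans ?_
  refine (dist_pi_le_iff dist_nonneg).2 fun k => ?_
  exact dist_le_pi_dist (initialSegment j z) (initialSegment j y) (Fin.castLE hij k)

/-- A basic neighbourhood of `z` missing `F` restricts finitely many coordinates, so long initial
segments keep a distance `δ` from those of `F`, and `j * δ` reaches 1. For empty `F` this fails, as
`Metric.infDist` is then 0. -/
lemma eventually_cylinderGap_eq_one {F : Set (ℕ → ℝ)} (hF : F.Nonempty) (hc : IsClosed F)
    {z : ℕ → ℝ} (hz : z ∉ F) : ∀ᶠ j in atTop, cylinderGap F j (initialSegment j z) = 1 := by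
  have hnhds : Fᶜ ∈ 𝓝 z := hc.isOpen_compl.mem_nhds hz
  rw [nhds_pi, Filter.mem_pi] at hnhds
  obtain ⟨I, hI, t, ht, hsub⟩ := hnhds
  have hball : ∀ i, ∃ ε > 0, Metric.ball (z i) ε ⊆ t i := fun i => Metric.mem_nhds_iff.1 (ht i)
  choose ε hε hεt using hball
  obtain ⟨δ, hδ, hδε⟩ : ∃ δ > 0, ∀ i ∈ I, δ ≤ ε i := by
    rcases I.eq_empty_or_nonempty with rfl | hne
    · exact ⟨1, one_pos, by simp⟩
    · obtain ⟨i₀, -, h⟩ := Set.exists_min_image I ε hI hne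
      exact ⟨ε i₀, hε i₀, h⟩
  obtain ⟨N, hN⟩ := hI.bddAbove
  obtain ⟨m, hm⟩ := exists_nat_ge (1 / δ)
  filter_upwards [eventually_gt_atTop N, eventually_ge_atTop m] with j hj hjm
  refine min_eq_left ?_
  have h1 : δ ≤ Metric.infDist (initialSegment j z) (initialSegment j '' F) := by
    refine (Metric.le_infDist (hF.image _)).2 ?_
    rintro _ ⟨y, hy, rfl⟩
    by_contra! hlt
    refine hsub (fun i hi => hεt i ?_) hy
    have hij : i < j := (hN hi).trans_lt hj
    rw [Metric.mem_ball, dist_comm]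
    exact (dist_le_pi_dist (initialSegment j z) (initialSegment j y) ⟨i, hij⟩).trans_lt
      (hlt.trans_le (hδε i hi))
  have h2 : 1 / δ ≤ j := hm.trans (Nat.cast_le.2 hjm)
  calc (1 : ℝ) = 1 / δ * δ := by field_simp
    _ ≤ _ := mul_le_mul h2 h1 hδ.le j.cast_nonneg

end CylinderApproximation

/-! ### From a dominated law to a member of the family. -/

namespace SublinearExpectationSpace

variable {Ω : Type*} [MeasurableSpace Ω] {S : SublinearExpectationSpace Ω}
  {Pfam : Set (@Measure Ω S.sigmaH)}

/-- The law `Q` of a sequence is dominated by the sub-linear distribution of `X`. -/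
def IsDominatedLaw (S : SublinearExpectationSpace Ω) (X : ℕ → Ω → ℝ) (Q : Measure (ℕ → ℝ)) :
    Prop :=
  ∀ (n : ℕ) (g : (Fin n → ℝ) → ℝ), IsBddLip g →
    ∫ z, g (initialSegment n z) ∂Q ≤ (S.E fun ω => g fun i => X i ω).toReal

/-- A Borel event which is almost sure under a dominated law is almost sure under some member of the
representing family. -/
theorem CC.exists_measure_eq_one (hCC : S.CC Pfam) {X : ℕ → Ω → ℝ} (hX : ∀ i, X i ∈ S.H)
    {Q : Measure (ℕ → ℝ)} [IsProbabilityMeasure Q] (hQ : S.IsDominatedLaw X Q)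
    {A : Set (ℕ → ℝ)} (hA : MeasurableSet A) (hQA : Q A = 1) :
    ∃ P ∈ Pfam, P {ω | (fun i => X i ω) ∈ A} = 1 := by
  have hXm := measurable_sigmaH_pi hX
  have hclosed : ∀ k : ℕ, ∃ F ⊆ A, IsClosed F ∧ Q.real Fᶜ ≤ (1 / 4) ^ (k + 1) := fun k => by
    obtain ⟨F, hFA, hF, hlt⟩ := hA.exists_isClosed_sdiff_lt (measure_ne_top Q A)
      (ε := ENNReal.ofReal ((1 / 4) ^ (k + 1)))
      (by rw [Ne, ENNReal.ofReal_eq_zero, not_le]; positivity)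
    refine ⟨F, hFA, hF, ENNReal.toReal_le_of_le_ofReal (by positivity) (le_trans ?_ hlt.le)⟩
    calc Q Fᶜ ≤ Q (Aᶜ ∪ A \ F) := measure_mono fun z hz => by
          by_cases h : z ∈ A
          · exact Or.inr ⟨h, hz⟩
          · exact Or.inl h
      _ ≤ Q Aᶜ + Q (A \ F) := measure_union_le _ _
      _ = Q (A \ F) := by rw [(prob_compl_eq_zero_iff hA).2 hQA, zero_add]
  choose F hFA hF hFQ using hclosed
  have hFne : ∀ k, (F k).Nonempty := fun k => by
    by_contra hne
    rw [Set.not_nonempty_iff_eq_empty] at hne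
    have h1 := hFQ k
    rw [hne, Set.compl_empty, probReal_univ] at h1
    exact absurd h1 (not_le.2 (pow_lt_one₀ (by norm_num) (by norm_num) k.succ_ne_zero))
  -- The weights `2 ^ k` grow, yet against the masses `(1 / 4) ^ (k + 1)` the sum has `Q`-mean at
  -- most 1. Both the number of terms and each gap increase with `j`.
  set f : (j : ℕ) → (Fin j → ℝ) → ℝ := fun j p =>
    ∑ k ∈ Finset.range j, 2 ^ k * cylinderGap (F k) j p with hf
  have hfL : ∀ j, IsBddLip (f j) := fun j =>
    IsBddLip.sum _ fun k _ => (isBddLip_cylinderGap (F k) j).const_mul _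
  have hfmono : ∀ {i j : ℕ}, i ≤ j → ∀ z, f i (initialSegment i z) ≤ f j (initialSegment j z) := by
    intro i j hij z
    refine (Finset.sum_le_sum fun k _ => mul_le_mul_of_nonneg_left
      (cylinderGap_mono (hFne k) z hij) (by positivity)).trans ?_
    exact Finset.sum_le_sum_of_subset_of_nonneg (Finset.range_subset_range.2 hij) fun k _ _ =>
      mul_nonneg (by positivity) (cylinderGap_nonneg _ _ _)
  have hGi : ∀ k j, Integrable (fun z => cylinderGap (F k) j (initialSegment j z)) Q :=
    fun k j => Integrable.of_bound ((isBddLip_cylinderGap (F k) j).measurable.comp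
      (measurable_initialSegment j)).aestronglyMeasurable 1 (ae_of_all _ fun z => by
        rw [Real.norm_eq_abs, abs_of_nonneg (cylinderGap_nonneg _ _ _)]
        exact cylinderGap_le_one _ _ _)
  have hGQ : ∀ k j, ∫ z, cylinderGap (F k) j (initialSegment j z) ∂Q ≤ (1 / 4) ^ (k + 1) := by
    intro k j
    refine le_trans ?_ (hFQ k)
    rw [← integral_indicator_one (hF k).isOpen_compl.measurableSet]
    refine integral_mono (hGi k j) ((integrable_const (1 : ℝ)).indicator
      (hF k).isOpen_compl.measurableSet) fun z => ?_
    by_cases hz : z ∈ F k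
    · simp [cylinderGap_eq_zero hz, hz]
    · simpa [hz] using cylinderGap_le_one (F k) j (initialSegment j z)
  have hfQ : ∀ j, ∫ z, f j (initialSegment j z) ∂Q ≤ 1 := by
    intro j
    simp only [hf]
    rw [integral_finsetSum _ fun k _ => (hGi k j).const_mul _]
    simp only [integral_const_mul]
    calc _ ≤ ∑ k ∈ Finset.range j, 2 ^ k * (1 / 4 : ℝ) ^ (k + 1) :=
          Finset.sum_le_sum fun k _ => mul_le_mul_of_nonneg_left (hGQ k j) (by positivity)
      _ = 1 / 4 * ∑ k ∈ Finset.range j, (1 / 2 : ℝ) ^ k := by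
          rw [Finset.mul_sum]
          refine Finset.sum_congr rfl fun k _ => ?_
          rw [pow_succ, ← mul_assoc, ← mul_pow, mul_comm]
          norm_num
      _ ≤ 1 := by linarith [sum_geometric_two_le j]
  set W : ℕ → Ω → ℝ := fun j ω => f j (fun i => X i ω) with hW
  have hWb : ∀ j, W j ∈ S.Hb := fun j => bddLip_comp_mem (hfL j) fun i => hX i
  have hWmono : ∀ {i j : ℕ}, i ≤ j → ∀ ω, W i ω ≤ W j ω := fun hij ω =>
    hfmono hij fun i => X i ω
  -- Domination applied to `-f j` gives upper expectation at least `-1`, so some member exceeds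
  -- `-2`.
  have hex : ∀ j, ∃ P ∈ Pfam, ∫ ω, W j ω ∂P ≤ 2 := by
    intro j
    have h1 := hQ j _ (hfL j).neg
    rw [integral_neg] at h1
    obtain ⟨P, hP, h2⟩ := hCC.exists_lt_integral
      (bddLip_comp_mem (hfL j).neg (X := fun i : Fin j => X i) fun i => hX i) (a := -2)
      (by linarith [hfQ j])
    rw [integral_neg] at h2
    exact ⟨P, hP, by linarith⟩
  choose P hP hPW using hex
  obtain ⟨P', hP', hlim⟩ := hCC.exists_tendsto_integral hWb hP (hyperfilter ℕ)
  have hprob := hCC.isProbability P' hP'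
  -- Monotonicity bounds the mean of `W i` under `P n` by that of `W n` for `n ≥ i`, so one limit
  -- measure controls all `i`.
  have hW2 : ∀ i, ∫ ω, W i ω ∂P' ≤ 2 := fun i => by
    refine le_of_tendsto (hlim i) (Nat.hyperfilter_le_atTop ?_)
    filter_upwards [eventually_ge_atTop i] with n hn
    have := hCC.isProbability (P n) (hP n)
    exact (integral_mono (integrable_of_mem_Hb (hWb i)) (integrable_of_mem_Hb (hWb n))
      fun ω => hWmono hn ω).trans (hPW n)
  have hset : ∀ {B : Set (ℕ → ℝ)}, MeasurableSet B →
      MeasurableSet[S.sigmaH] {ω | (fun i => X i ω) ∈ B} := fun hB => hXm hB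
  -- The `k`-th summand alone has mean at most 2; then `j → ∞` turns its gap into the indicator of
  -- the complement of `F k`.
  have hbound : ∀ k, P'.real {ω | (fun i => X i ω) ∈ (F k)ᶜ} ≤ 2 * (1 / 2) ^ k := by
    intro k
    have hGb : ∀ j, (fun ω => cylinderGap (F k) j fun i => X i ω) ∈ S.Hb := fun j =>
      bddLip_comp_mem (isBddLip_cylinderGap (F k) j) fun i => hX i
    have hk : ∀ j, k < j → ∫ ω, cylinderGap (F k) j (fun i => X i ω) ∂P' ≤ 2 * (1 / 2) ^ k := by
      intro j hj
      have h1 : 2 ^ k * ∫ ω, cylinderGap (F k) j (fun i => X i ω) ∂P' ≤ 2 := by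
        rw [← integral_const_mul]
        refine (integral_mono ((integrable_of_mem_Hb (hGb j)).const_mul _)
          (integrable_of_mem_Hb (hWb j)) fun ω => ?_).trans (hW2 j)
        exact Finset.single_le_sum (f := fun k => 2 ^ k * cylinderGap (F k) j fun i => X i ω)
          (fun k _ => mul_nonneg (by positivity) (cylinderGap_nonneg _ _ _))
          (Finset.mem_range.2 hj)
      rw [one_div, inv_pow, ← div_eq_mul_inv, le_div_iff₀ (by positivity), mul_comm]
      exact h1
    have hms := hset (hF k).isOpen_compl.measurableSet
    rw [← integral_indicator_one hms]
    refine le_of_tendsto (f := fun j => ∫ ω, cylinderGap (F k) j (fun i => X i ω) ∂P')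
      (x := atTop) ?_ ?_
    · refine tendsto_integral_of_dominated_convergence (fun _ => 1)
        (fun j => (measurable_sigmaH (hGb j).1).aestronglyMeasurable) (integrable_const 1)
        (fun j => ae_of_all _ fun ω => ?_) (ae_of_all _ fun ω => ?_)
      · rw [Real.norm_eq_abs, abs_of_nonneg (cylinderGap_nonneg _ _ _)]
        exact cylinderGap_le_one _ _ _
      · by_cases hω : (fun i => X i ω) ∈ F k
        · have h0 : ∀ j, cylinderGap (F k) j (fun i => X i ω) = 0 := fun j =>
            cylinderGap_eq_zero hω j
          simp [h0, hω]
        · refine tendsto_const_nhds.congr' ?_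
          filter_upwards [eventually_cylinderGap_eq_one (hFne k) (hF k) hω] with j hj
          have h1 : cylinderGap (F k) j (fun i => X i ω) = 1 := hj
          simp [h1, hω]
    · filter_upwards [eventually_gt_atTop k] with j hj using hk j hj
  refine ⟨P', hP', ?_⟩
  have h0 : P'.real {ω | (fun i => X i ω) ∈ Aᶜ} ≤ 0 := by
    have h2 : Tendsto (fun k : ℕ => 2 * (1 / 2 : ℝ) ^ k) atTop (𝓝 (2 * 0)) :=
      (tendsto_pow_atTop_nhds_zero_of_lt_one (by norm_num) (by norm_num)).const_mul 2
    rw [mul_zero] at h2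
    refine ge_of_tendsto' h2 fun k => le_trans ?_ (hbound k)
    exact measureReal_mono fun ω hω hωF => hω (hFA k hωF)
  have h1 : P' {ω | (fun i => X i ω) ∈ A}ᶜ = 0 := by
    have := le_antisymm h0 measureReal_nonneg
    rwa [measureReal_eq_zero_iff] at this
  exact (prob_compl_eq_zero_iff (hset hA)).1 h1

end SublinearExpectationSpace

/-! ### Centring by mixing two laws. -/

section BalancedKernel

open ProbabilityTheory

/-- Two laws on which a function of a parameter has non-negative and non-positive means have
mixtures, depending measurably on the parameter, on which it has mean zero. -/
lemma exists_balanced_kernel {α : Type*} [MeasurableSpace α] (θ₁ θ₂ : Measure ℝ)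
    [IsProbabilityMeasure θ₁] [IsProbabilityMeasure θ₂] {D : α × ℝ → ℝ} (hD : Measurable D)
    (hD₁ : ∀ p, Integrable (fun x => D (p, x)) θ₁) (hD₂ : ∀ p, Integrable (fun x => D (p, x)) θ₂)
    (h₁ : ∀ p, 0 ≤ ∫ x, D (p, x) ∂θ₁) (h₂ : ∀ p, ∫ x, D (p, x) ∂θ₂ ≤ 0) :
    ∃ κ : Kernel α ℝ, IsMarkovKernel κ ∧ (∀ p, κ p ≤ θ₁ + θ₂) ∧
      (∀ p, ∫ x, D (p, x) ∂κ p = 0) ∧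
      ∀ p (f : ℝ → ℝ) (c : ℝ), Integrable f θ₁ → Integrable f θ₂ → ∫ x, f x ∂θ₁ ≤ c →
        ∫ x, f x ∂θ₂ ≤ c → ∫ x, f x ∂κ p ≤ c := by
  set a : α → ℝ := fun p => ∫ x, D (p, x) ∂θ₁ with ha
  set b : α → ℝ := fun p => -∫ x, D (p, x) ∂θ₂ with hb
  have ham : Measurable a := hD.stronglyMeasurable.integral_prod_right'.measurable
  have hbm : Measurable b := hD.stronglyMeasurable.integral_prod_right'.measurable.neg
  have ha0 : ∀ p, 0 ≤ a p := h₁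
  have hb0 : ∀ p, 0 ≤ b p := fun p => neg_nonneg.2 (h₂ p)
  -- The solution of `w a = (1 - w) b`. If `a = b = 0`, division by zero gives `w = 0`, and any
  -- weight would do.
  set w : α → ℝ := fun p => b p / (a p + b p) with hw
  have hwm : Measurable w := hbm.div (ham.add hbm)
  have hw0 : ∀ p, 0 ≤ w p := fun p => div_nonneg (hb0 p) (add_nonneg (ha0 p) (hb0 p))
  have hw1 : ∀ p, w p ≤ 1 := fun p =>
    div_le_one_of_le₀ (le_add_of_nonneg_left (ha0 p)) (add_nonneg (ha0 p) (hb0 p))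
  have hbal : ∀ p, w p * a p + (1 - w p) * (-b p) = 0 := fun p => by
    by_cases h : a p + b p = 0
    · have h3 : a p = 0 := by linarith [ha0 p, hb0 p]
      have h4 : b p = 0 := by linarith [ha0 p, hb0 p]
      simp [h3, h4]
    · simp only [hw]
      field_simp
      ring
  set m : α → Measure ℝ := fun p =>
    ENNReal.ofReal (w p) • θ₁ + ENNReal.ofReal (1 - w p) • θ₂ with hm
  have hmm : Measurable m := by
    refine Measure.measurable_of_measurable_coe _ fun s hs => ?_
    simp only [hm, Measure.add_apply, Measure.smul_apply, smul_eq_mul]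
    exact (hwm.ennreal_ofReal.mul_const _).add ((hwm.const_sub 1).ennreal_ofReal.mul_const _)
  have hint : ∀ p (f : ℝ → ℝ), Integrable f θ₁ → Integrable f θ₂ →
      ∫ x, f x ∂m p = w p * ∫ x, f x ∂θ₁ + (1 - w p) * ∫ x, f x ∂θ₂ := fun p f hf1 hf2 => by
    simp only [hm]
    rw [integral_add_measure (hf1.smul_measure ENNReal.ofReal_ne_top)
      (hf2.smul_measure ENNReal.ofReal_ne_top), integral_smul_measure, integral_smul_measure,
      ENNReal.toReal_ofReal (hw0 p), ENNReal.toReal_ofReal (sub_nonneg.2 (hw1 p)), smul_eq_mul,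
      smul_eq_mul]
  refine ⟨⟨m, hmm⟩, ⟨fun p => ⟨?_⟩⟩, fun p => ?_, fun p => ?_, fun p f c hf1 hf2 hc1 hc2 => ?_⟩
  · change m p Set.univ = 1
    simp only [hm, Measure.add_apply, Measure.smul_apply, smul_eq_mul, measure_univ, mul_one]
    rw [← ENNReal.ofReal_add (hw0 p) (sub_nonneg.2 (hw1 p))]
    simp
  · change m p ≤ _
    refine Measure.le_iff.2 fun s _ => ?_
    simp only [hm, Measure.add_apply, Measure.smul_apply, smul_eq_mul]
    refine add_le_add (mul_le_of_le_one_left zero_le ?_) (mul_le_of_le_one_left zero_le ?_)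
    · exact ENNReal.ofReal_le_one.2 (hw1 p)
    · exact ENNReal.ofReal_le_one.2 (by linarith [hw0 p])
  · refine (hint p _ (hD₁ p) (hD₂ p)).trans ?_
    rw [← hbal p]
    simp [ha, hb]
  · refine (hint p f hf1 hf2).trans_le ?_
    nlinarith [mul_le_mul_of_nonneg_left hc1 (hw0 p),
      mul_le_mul_of_nonneg_left hc2 (sub_nonneg.2 (hw1 p))]

end BalancedKernel

/-! ### Domination of the chain, and the strong law in the family. -/

namespace SublinearExpectationSpace

open ProbabilityTheory

variable {Ω : Type*} [MeasurableSpace Ω] {S : SublinearExpectationSpace Ω}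
  {Pfam : Set (@Measure Ω S.sigmaH)}

/-- If the conditional laws of a chain are dominated by the sub-linear distribution of an i.i.d.
sequence, then so is the law of the chain. -/
theorem IsIID.isDominatedLaw {X : ℕ → Ω → ℝ} (hX : S.IsIID X) {Q : Measure (ℕ → ℝ)}
    [IsProbabilityMeasure Q] {κ : (n : ℕ) → Kernel (Fin n → ℝ) ℝ} [∀ n, IsMarkovKernel (κ n)]
    (hQ : IsChainLaw Q κ)
    (hκ : ∀ n p (h : ℝ → ℝ), IsBddLip h → ∫ x, h x ∂κ n p ≤ (S.E fun ω => h (X 0 ω)).toReal) :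
    S.IsDominatedLaw X Q := by
  intro n
  induction n with
  | zero =>
    intro g _
    have h1 : ∀ p : Fin 0 → ℝ, g p = g Fin.elim0 := fun p => congrArg g (Subsingleton.elim _ _)
    simp only [h1 (initialSegment 0 _), fun ω => h1 fun i => X i ω]
    rw [S.const]
    simp
  | succ n ih =>
    intro g hg
    set φ : (Fin n → ℝ) × ℝ → ℝ := fun q => g (Fin.snoc (α := fun _ => ℝ) q.1 q.2) with hφ
    have hφL : IsBddLip φ := hg.comp (lipschitzWith_snoc n)
    have hφp : ∀ p, IsBddLip fun x => φ (p, x) := fun p =>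
      hφL.comp (LipschitzWith.prodMk_left p)
    have hmem : ∀ p, (fun ω => φ (p, X n ω)) ∈ S.Hb := fun p =>
      bddLip_comp_mem (n := 1) (φ := fun y => φ (p, y 0))
        ((hφp p).comp (LipschitzWith.eval (α := fun _ : Fin 1 => ℝ) 0))
        (X := fun _ => X n) fun _ => hX.mem n
    set ψ : (Fin n → ℝ) → ℝ := fun p => (S.E fun ω => φ (p, X n ω)).toReal with hψ
    -- `S.E` is 1-Lipschitz for the supremum distance, so integrating out the last variable stays in
    -- the class on which the induction runs.
    have hψL : IsBddLip ψ := by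
      obtain ⟨⟨M, hM⟩, K, hK⟩ := hφL
      refine ⟨⟨M, fun p => abs_toReal_E_le (hmem p).1 fun ω => hM _⟩, K, ?_⟩
      refine LipschitzWith.of_le_add_mul K fun p q => ?_
      refine toReal_E_le_add (hmem p) (hmem q) fun ω => ?_
      have := hK.dist_le_mul (p, X n ω) (q, X n ω)
      rw [Prod.dist_eq, dist_self, max_eq_left dist_nonneg, Real.dist_eq] at this
      linarith [le_abs_self (φ (p, X n ω) - φ (q, X n ω))]
    have hid : ∀ p, S.E (fun ω => φ (p, X n ω)) = S.E (fun ω => φ (p, X 0 ω)) := fun p =>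
      hX.identDist n (fun y => φ (p, y 0))
        ((hφp p).comp (LipschitzWith.eval (α := fun _ : Fin 1 => ℝ) 0))
    have hsnoc : ∀ z : ℕ → ℝ, g (initialSegment (n + 1) z) = φ (initialSegment n z, z n) :=
      fun z => congrArg g (snoc_eq z).symm
    obtain ⟨M, hM⟩ := hφL.1
    have hφi : Integrable (fun z => φ (initialSegment n z, z n)) Q :=
      Integrable.of_bound (hφL.measurable.comp
        (measurable_initialSegment_prodMk n)).aestronglyMeasurable M (ae_of_all _ fun z => hM _)
    have h1 : ∫ z, g (initialSegment (n + 1) z) ∂Q ≤ ∫ z, ψ (initialSegment n z) ∂Q := by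
      simp_rw [hsnoc]
      rw [hQ.integral_eq n hφL.measurable hφi]
      obtain ⟨M', hM'⟩ := hψL.1
      refine integral_mono ?_ (Integrable.of_bound (hψL.measurable.comp
        (measurable_initialSegment n)).aestronglyMeasurable M' (ae_of_all _ fun z => hM' _))
        fun z => ?_
      · refine Integrable.of_bound ((hφL.measurable.stronglyMeasurable.integral_kernel_prod_right'
          (κ := κ n)).measurable.comp (measurable_initialSegment n)).aestronglyMeasurable M
          (ae_of_all _ fun z => ?_)
        simpa using norm_integral_le_of_norm_le_const (μ := κ n (initialSegment n z))
          (f := fun x => φ (initialSegment n z, x)) (C := M) (ae_of_all _ fun x => hM _)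
      · refine (hκ n _ _ (hφp (initialSegment n z))).trans_eq ?_
        simp only [hψ]
        rw [hid]
    have h2 : S.E (fun ω => ψ fun i => X i ω) = S.E fun ω => g fun i => X i ω := by
      have h3 : ∀ ω, (g fun i => X i ω) = φ (fun i => X i ω, X n ω) := fun ω =>
        hsnoc fun i => X i ω
      simp_rw [h3]
      -- For the first variable independence says nothing, but the past is empty and `ψ` is
      -- constant.
      cases n with
      | zero =>
        have h4 : ∀ p : Fin 0 → ℝ, p = Fin.elim0 := fun p => Subsingleton.elim _ _
        have h5 : ∀ p : Fin 0 → ℝ, ψ p = ψ Fin.elim0 := fun p => by rw [h4 p]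
        have h6 : ∀ ω, φ (fun i => X i ω, X 0 ω) = φ (Fin.elim0, X 0 ω) := fun ω => by
          rw [h4 fun i : Fin 0 => X i ω]
        simp only [h6]
        simp_rw [h5]
        rw [S.const]
        exact coe_toReal_E (hmem _)
      | succ i =>
        refine (hX.indep i (fun q => φ (q.1, q.2 0)) (hφL.comp (K := 1) ?_)).symm
        refine LipschitzWith.of_dist_le_mul fun q r => ?_
        rw [NNReal.coe_one, one_mul]
        exact max_le_max le_rfl (dist_le_pi_dist q.2 r.2 0)
    rw [← h2]
    exact h1.trans (ih ψ hψL)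

/-- The strong law holds under a member of the representing family, for any Borel functions with
values between the means of `X 0` under two members of the family. -/
theorem CC.exists_measure_convSet_eq_one (hCC : S.CC Pfam) {X : ℕ → Ω → ℝ} (hX : S.IsIID X)
    {P₁ P₂ : @Measure Ω S.sigmaH} (hP₁ : P₁ ∈ Pfam) (hP₂ : P₂ ∈ Pfam)
    (hi₁ : Integrable (X 0) P₁) (hi₂ : Integrable (X 0) P₂)
    {φ : (i : ℕ) → (Fin (i + 1) → ℝ) → ℝ} (hφ : ∀ i, Measurable (φ i))
    (hφI : ∀ i x, φ i x ∈ Set.Icc (∫ ω, X 0 ω ∂P₂) (∫ ω, X 0 ω ∂P₁)) :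
    ∃ P ∈ Pfam, P (convSet X φ) = 1 := by
  have hXm := measurable_sigmaH (hX.mem 0)
  have hp₁ := hCC.isProbability P₁ hP₁
  have hp₂ := hCC.isProbability P₂ hP₂
  set μhi : ℝ := ∫ ω, X 0 ω ∂P₁ with hμhi
  set μlo : ℝ := ∫ ω, X 0 ω ∂P₂ with hμlo
  let θ₁ : Measure ℝ := @Measure.map Ω ℝ S.sigmaH _ (X 0) P₁
  let θ₂ : Measure ℝ := @Measure.map Ω ℝ S.sigmaH _ (X 0) P₂
  have hθ₁ : IsProbabilityMeasure θ₁ := Measure.isProbabilityMeasure_map hXm.aemeasurable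
  have hθ₂ : IsProbabilityMeasure θ₂ := Measure.isProbabilityMeasure_map hXm.aemeasurable
  have hI₁ : Integrable id θ₁ :=
    (integrable_map_measure measurable_id.aestronglyMeasurable hXm.aemeasurable).2 hi₁
  have hI₂ : Integrable id θ₂ :=
    (integrable_map_measure measurable_id.aestronglyMeasurable hXm.aemeasurable).2 hi₂
  have hM₁ : ∫ x, x ∂θ₁ = μhi := integral_map hXm.aemeasurable measurable_id.aestronglyMeasurable
  have hM₂ : ∫ x, x ∂θ₂ = μlo := integral_map hXm.aemeasurable measurable_id.aestronglyMeasurable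
  set C : ℝ := max |μlo| |μhi| with hC
  have hφC : ∀ i x, |φ i x| ≤ C := fun i x => abs_le_max_abs_abs (hφI i x).1 (hφI i x).2
  -- `φ n` also sees the present value, so prescribing the conditional mean of `x` would not
  -- suffice; the whole difference must be centred.
  set D : (n : ℕ) → (Fin n → ℝ) × ℝ → ℝ := fun n q =>
    q.2 - φ n (Fin.snoc (α := fun _ => ℝ) q.1 q.2) with hD
  have hsm : ∀ n, Measurable fun q : (Fin n → ℝ) × ℝ =>
      φ n (Fin.snoc (α := fun _ => ℝ) q.1 q.2) := fun n =>
    (hφ n).comp (lipschitzWith_snoc n).continuous.measurable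
  have hDm : ∀ n, Measurable (D n) := fun n => measurable_snd.sub (hsm n)
  have hφi : ∀ (θ : Measure ℝ) [IsProbabilityMeasure θ] (n : ℕ) (p : Fin n → ℝ),
      Integrable (fun x => φ n (Fin.snoc (α := fun _ => ℝ) p x)) θ := fun θ _ n p =>
    Integrable.of_bound ((hsm n).comp measurable_prodMk_left).aestronglyMeasurable C
      (ae_of_all _ fun x => hφC n _)
  have hker := fun n => exists_balanced_kernel θ₁ θ₂ (hDm n)
    (fun p => hI₁.sub (hφi θ₁ n p)) (fun p => hI₂.sub (hφi θ₂ n p))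
    (fun p => by
      simp only [hD]
      rw [integral_sub (f := fun x => x) hI₁ (hφi θ₁ n p)]
      have h1 := integral_mono (hφi θ₁ n p) (integrable_const μhi) fun x => (hφI n _).2
      simp only [integral_const, probReal_univ, one_smul] at h1
      exact sub_nonneg.2 (h1.trans_eq hM₁.symm))
    (fun p => by
      simp only [hD]
      rw [integral_sub (f := fun x => x) hI₂ (hφi θ₂ n p)]
      have h1 := integral_mono (integrable_const μlo) (hφi θ₂ n p) fun x => (hφI n _).1
      simp only [integral_const, probReal_univ, one_smul] at h1
      exact sub_nonpos.2 (hM₂.trans_le h1))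
  choose κ hκM hκle hκ0 hκc using hker
  obtain ⟨Q, hQp, hQ⟩ := exists_isChainLaw κ
  have hθE : ∀ P ∈ Pfam, ∀ h : ℝ → ℝ, IsBddLip h →
      ∫ x, h x ∂(@Measure.map Ω ℝ S.sigmaH _ (X 0) P) ≤ (S.E fun ω => h (X 0 ω)).toReal := by
    intro P hP h hh
    rw [integral_map hXm.aemeasurable hh.measurable.aestronglyMeasurable]
    exact hCC.integral_le hP (bddLip_comp_mem (n := 1) (φ := fun y => h (y 0))
      (hh.comp (LipschitzWith.eval (α := fun _ : Fin 1 => ℝ) 0))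
      (X := fun _ => X 0) fun _ => hX.mem 0)
  have hdom : S.IsDominatedLaw X Q := hX.isDominatedLaw hQ fun n p h hh => by
    obtain ⟨M, hM⟩ := hh.1
    have hi : ∀ (θ : Measure ℝ) [IsProbabilityMeasure θ], Integrable h θ := fun θ _ =>
      Integrable.of_bound hh.measurable.aestronglyMeasurable M (ae_of_all _ hM)
    exact hκc n p h _ (hi θ₁) (hi θ₂) (hθE P₁ hP₁ h hh) (hθE P₂ hP₂ h hh)
  have hlim := hQ.ae_tendsto_average hI₁ hI₂ hκle hDm (C := C)
    ((abs_nonneg _).trans (le_max_left _ _)) (fun n p x => by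
      simp only [hD]
      exact (abs_sub _ _).trans (by linarith [hφC n (Fin.snoc (α := fun _ => ℝ) p x)])) hκ0
  let A : Set (ℕ → ℝ) := {z | Tendsto (fun n : ℕ =>
    (∑ i ∈ Finset.range n, z i - ∑ i ∈ Finset.range n, φ i (initialSegment (i + 1) z)) / (n : ℝ))
      atTop (𝓝 0)}
  -- `convSet` is by definition the preimage of `A` under the sequence `X`.
  change ∃ P ∈ Pfam, P {ω | (fun i => X i ω) ∈ A} = 1
  have hmeas : MeasurableSet A := by
    refine measurableSet_tendsto _ fun n => ?_
    refine Measurable.div_const (Measurable.sub ?_ ?_) _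
    · exact Finset.measurable_fun_sum _ fun i _ => measurable_pi_apply i
    · exact Finset.measurable_fun_sum _ fun i _ => (hφ i).comp (measurable_initialSegment _)
  refine hCC.exists_measure_eq_one hX.mem hdom hmeas ((prob_compl_eq_zero_iff hmeas).1 ?_)
  refine mem_ae_iff.1 ?_
  filter_upwards [hlim] with z hz
  refine hz.congr fun n => ?_
  rw [← Finset.sum_sub_distrib]
  congr 1
  refine Finset.sum_congr rfl fun i _ => ?_
  simp only [hD]
  rw [show Fin.snoc (α := fun _ => ℝ) (initialSegment i z) (z i) = initialSegment (i + 1) z from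
    snoc_eq z]

end SublinearExpectationSpace

/-! ### The theorem. -/

theorem theorem2p2 {Ω : Type*} [MeasurableSpace Ω] (S : SublinearExpectationSpace Ω)
    (Pfam : Set (@MeasureTheory.Measure Ω S.sigmaH)) (hCC : S.CC Pfam)
    (X : ℕ → Ω → ℝ) (hX : S.IsIID X) (hC : S.choquet (fun ω => |X 0 ω|) < ⊤) :
    ∃ μlo μhi : ℝ, S.HasLowerMean (X 0) μlo ∧ S.HasUpperMean (X 0) μhi ∧
      (∀ φ : (i : ℕ) → (Fin (i + 1) → ℝ) → ℝ,
        (∀ i, Measurable (φ i)) → (∀ i x, φ i x ∈ Set.Icc μlo μhi) →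
        ∃ Q : @MeasureTheory.Measure Ω S.sigmaH, MeasureTheory.IsProbabilityMeasure Q ∧
          (∀ Y ∈ S.Hb, ((∫ ω, Y ω ∂Q : ℝ) : EReal) ≤ S.E Y) ∧
          S.outerCapacity (SublinearExpectationSpace.convSet X φ) = 1 ∧
          Q (SublinearExpectationSpace.convSet X φ) = 1) ∧
      (∀ φ : (i : ℕ) → (Fin (i + 1) → ℝ) → ℝ,
        (∀ i, Continuous (φ i)) → (∀ i x, φ i x ∈ Set.Icc μlo μhi) →
        ∃ P ∈ Pfam,
          S.outerCapacity (SublinearExpectationSpace.convSet X φ) = 1 ∧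
          P (SublinearExpectationSpace.convSet X φ) = 1) := by
  have hXH := hX.mem 0
  have hnegH : -X 0 ∈ S.H := S.H.neg_mem hXH
  have htail := hCC.capacityTail_ne_top_of_choquet hC
  have htail' : S.capacityTail (-X 0) 0 ≠ ⊤ := by
    simpa [SublinearExpectationSpace.capacityTail] using htail
  obtain ⟨μhi, hhi, P₁, hP₁, hμ₁⟩ := hCC.exists_hasUpperMean hXH htail
  obtain ⟨ν, hlo, P₂, hP₂, hμ₂⟩ := hCC.exists_hasUpperMean hnegH htail'
  have hμ₂' : ∫ ω, X 0 ω ∂P₂ = -ν := by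
    rw [← hμ₂]
    simp [integral_neg]
  -- Measurability alone already yields a member of the family, so the first claim takes `Q` in
  -- `Pfam` and the second is a special case.
  have key : ∀ φ : (i : ℕ) → (Fin (i + 1) → ℝ) → ℝ, (∀ i, Measurable (φ i)) →
      (∀ i x, φ i x ∈ Set.Icc (-ν) μhi) →
      ∃ P ∈ Pfam, P (SublinearExpectationSpace.convSet X φ) = 1 := fun φ hφ hφI =>
    hCC.exists_measure_convSet_eq_one hX hP₁ hP₂ (hCC.integrable_of_capacityTail hP₁ hXH htail)
      (hCC.integrable_of_capacityTail hP₂ hXH htail) hφ (by rw [hμ₁, hμ₂']; exact hφI)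
  refine ⟨-ν, μhi, by simpa [SublinearExpectationSpace.HasLowerMean] using hlo, hhi,
    fun φ hφ hφI => ?_, fun φ hφ hφI => ?_⟩
  · obtain ⟨P, hP, h⟩ := key φ hφ hφI
    exact ⟨P, hCC.isProbability P hP, fun Y hY => hCC.integral_le_E hP hY,
      hCC.outerCapacity_eq_one hP h, h⟩
  · obtain ⟨P, hP, h⟩ := key φ (fun i => (hφ i).measurable) hφI
    exact ⟨P, hP, hCC.outerCapacity_eq_one hP h, h⟩
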